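/- Let $n\in\mathbb N$, $\hbar>0$, $\varkappa\in\mathbb R$, $\hat z=(\hat{\vec p},\vec x)=(-i\hbar\,\partial/\partial\vec x,\vec x)$, $J=\begin{pmatrix}0&-\mathbb I\\ \mathbb I&0\end{pmatrix}$. Let $\mathcal H_{zz}(t),W_{zz}(t),W_{ww}(t)$ (symmetric) and $W_{zw}(t)$ be real $2n\times 2n$ matrices and $\mathcal H_z(t)\in\mathbb R^{2n}$ a vector, all continuous in $t\in\mathbb R$. **Moments.** For $\psi:\mathbb R^n\to\mathbb C$ put $z_\psi=\langle\psi|\hat z|\psi\rangle/\|\psi\|^2$, $\Delta\hat z=\hat z-z_\psi$, $\Delta_{\psi,jk}=\langle\psi|\Delta\hat z_j\Delta\hat z_k+\Delta\hat z_k\Delta\hat z_j|\psi\rangle/(2\|\psi\|^2)$ and $\mathfrak g_0(\psi)=(z_\psi,\Delta_\psi)$, with $L_2$ scalar product and norm (for $\psi=0$ the quotients are read as $0$). For $\tilde\varkappa\in\mathbb R$ and $\mathfrak g=(z,\Delta)$ put $$\mathfrak H_{zz}(t)=\mathcal H_{zz}+\tilde\varkappa W_{zz},\qquad \mathfrak H_z(t,\mathfrak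 g)=\mathcal H_z+(\mathcal H_{zz}+\tilde\varkappa W_{zz}+\tilde\varkappa W_{zw})z,$$ $$\mathfrak H(t,\mathfrak g)=\tfrac12\langle z,[\mathcal H_{zz}+\tilde\varkappa(W_{zz}+2W_{zw}+W_{ww})]z\rangle+\langle\mathcal H_z,z\rangle+\tfrac12\tilde\varkappa\,\mathrm{Sp}(W_{ww}\Delta).$$ **Equation.** A solution of the nonlocal Gross–Pitaevskii equation (GPE) is a function $\Psi(\vec x,t)$ on $\mathbb R^n\times\mathbb R$ that is a Schwartz function of $\vec x$ for each $t$, is differentiable in $t$, and satisfies $$\Big\{-i\hbar\partial_t+\mathfrak H+\langle\mathfrak H_z,\Delta\hat z\rangle+\tfrac12\langle\Delta\hat z,\mathfrak H_{zz}\Delta\hat z\rangle\Big\}\Psi=0,$$ where $\tilde\varkappa=\varkappa\|\Psi(t)\|^2$, $\mathfrak g=\mathfrak g_0(\Psi(t))$ and $\Delta\hat z=\hat z-z_{\Psi(t)}$. **Trajectories and matriciant.** For given $\tilde\varkappa$, let $\mathfrak g(t)=(z(t),\Delta(t))$, $z=(\vec P,\vec X)$, denote solutions on $\mathbb R$ of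 the Hamilton–Ehrenfest system $$\dot z=J\mathfrak H_z(t,\mathfrak g),\qquad \dot\Delta=J\mathfrak H_{zz}\Delta-\Delta\mathfrak H_{zz}J,$$ and let $\mathcal A(t,s)=\begin{pmatrix}\lambda_4^{\intercal}&-\lambda_2^{\intercal}\\-\lambda_3^{\intercal}&\lambda_1^{\intercal}\end{pmatrix}$ solve $\partial_t\mathcal A=J\mathfrak H_{zz}(t)\mathcal A$, $\mathcal A(s,s)=\mathbb I$. **Green function.** Along a trajectory $\mathfrak g$ put $S(t)=\int_0^t\{\langle\vec P,\dot{\vec X}\rangle-\mathfrak H(\tau,\mathfrak g)\}\,d\tau$. If $\det\lambda_3(t,s)\ne0$, put, with $\Delta\vec x=\vec x-\vec X(t)$, $\Delta\vec y=\vec y-\vec X(s)$, $$G(\vec x,\vec y,t,s)=\frac1{\sqrt{\det(-2\pi i\hbar\lambda_3(t,s))}}\exp\Big\{\frac i\hbar\Big[S(t)-S(s)+\langle\vec P(t),\Delta\vec x\rangle-\langle\vec P(s),\Delta\vec y\rangle-\tfrac12\langle\Delta\vec y,\lambda_1\lambda_3^{-1}\Delta\vec y\rangle+\langle\Delta\vec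 x,\lambda_3^{-1}\Delta\vec y\rangle-\tfrac12\langle\Delta\vec x,\lambda_3^{-1}\lambda_4\Delta\vec x\rangle\Big]\Big\},$$ all $\lambda_k$ taken at $(t,s)$. The root is the branch continuing the limit $G\to\delta(\vec x-\vec y)$ as $t\to s$, namely $$\sqrt{\det(-2\pi i\hbar\lambda_3)}=(4\pi\hbar)^{n/2}\,\frac{\sqrt{f(t)}}{\sqrt{\det(\mathbb I+iN)}},\qquad f=\det\tfrac12\big(\lambda_1+\lambda_4+i(\lambda_2-\lambda_3)\big),\qquad N=\begin{pmatrix}\lambda_3^{-1}\lambda_4&-\lambda_3^{-1}\\-\lambda_3^{-\intercal}&\lambda_1\lambda_3^{-1}\end{pmatrix},$$ where $\sqrt{f}$ is continuous in $t$ and equal to $1$ at $t=s$, and $\sqrt{\det(\mathbb I+iN)}$ is the product of the principal square roots of the eigenvalues. **Evolution operators.** For a function $\psi$ take $\tilde\varkappa=\varkappa\|\psi\|^2$ and put $$\hat U_\varkappa(t,s,\psi)(\vec x)=\int_{\mathbb R^n}G(\vec x,\vec y,t,s)\,\psi(\vec y)\,d\vec y\quad\text{along the trajectory with }\mathfrak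 g(s)=\mathfrak g_0(\psi),$$ $$\hat U_\varkappa^{-1}(t,s,\psi)(\vec x)=\int_{\mathbb R^n}G(\vec x,\vec y,s,t)\,\psi(\vec y)\,d\vec y\quad\text{along the trajectory with }\mathfrak g(t)=\mathfrak g_0(\psi);$$ for $t=s$, where $G=\delta(\vec x-\vec y)$, both are the identity. **Claim.** Let $\Psi$ be a solution of the GPE and let $t,s\in\mathbb R$ be such that $t=s$ or $\det\lambda_3(t,s)\neq0$ for $\tilde\varkappa=\varkappa\|\Psi(t)\|^2$ (so that the Green function is given by the formula above). Then $$\hat U_\varkappa\big(t,s,\hat U_\varkappa^{-1}(t,s,\Psi(t))\big)(\vec x)=\Psi(\vec x,t)\qquad\text{for all }\vec x\in\mathbb R^n.$$ -/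

import Mathlib

open scoped Matrix SchwartzMap

noncomputable section

namespace NonlocalGPE

/-- Configuration space `ℝⁿ`. -/
abbrev Conf (n : ℕ) := EuclideanSpace ℝ (Fin n)

/-- Indices of the phase-space coordinates `z = (p, x)`: `Sum.inl j` is `p_j`, `Sum.inr j` is
`x_j`. -/
abbrev Idx (n : ℕ) := Fin n ⊕ Fin n

/-- The coefficients of the quadratic operators
`H(ẑ,t) = ½⟨ẑ, H_zz(t) ẑ⟩ + ⟨H_z(t), ẑ⟩` and
`V(ẑ,ŵ,t) = ½⟨ẑ, W_zz(t) ẑ⟩ + ⟨ẑ, W_zw(t) ŵ⟩ + ½⟨ŵ, W_ww(t) ŵ⟩`: real, continuous in time, with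
symmetric `H_zz`, `W_zz`, `W_ww`. -/
structure Coeffs (n : ℕ) where
  Hzz : ℝ → Matrix (Idx n) (Idx n) ℝ
  Hz : ℝ → Idx n → ℝ
  Wzz : ℝ → Matrix (Idx n) (Idx n) ℝ
  Wzw : ℝ → Matrix (Idx n) (Idx n) ℝ
  Www : ℝ → Matrix (Idx n) (Idx n) ℝ
  continuous_Hzz : Continuous Hzz
  continuous_Hz : Continuous Hz
  continuous_Wzz : Continuous Wzz
  continuous_Wzw : Continuous Wzw
  continuous_Www : Continuous Www
  symm_Hzz : ∀ t, (Hzz t).IsSymm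
  symm_Wzz : ∀ t, (Wzz t).IsSymm
  symm_Www : ∀ t, (Www t).IsSymm

/-- The matrix `J = (0, -I; I, 0)`. -/
def sympJ (n : ℕ) : Matrix (Idx n) (Idx n) ℝ := Matrix.fromBlocks 0 (-1) 1 0

/-! ### Operators and moments -/

/-- The operators `ẑ = (-iℏ ∂/∂x, x)`. -/
def zOp {n : ℕ} (hb : ℝ) (k : Idx n) (f : Conf n → ℂ) : Conf n → ℂ :=
  match k with
  | Sum.inl j => fun x => -Complex.I * hb * fderiv ℝ f x (EuclideanSpace.single j 1)
  | Sum.inr j => fun x => (x j : ℂ) * f x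

/-- The shifted operators `Δẑ = ẑ - z`. -/
def dzOp {n : ℕ} (hb : ℝ) (z : Idx n → ℝ) (k : Idx n) (f : Conf n → ℂ) : Conf n → ℂ :=
  fun x => zOp hb k f x - (z k : ℂ) * f x

/-- The scalar product `⟨φ|ψ⟩ = ∫ φ* ψ`. -/
def scal {n : ℕ} (φ ψ : Conf n → ℂ) : ℂ := ∫ x, star (φ x) * ψ x

/-- `‖ψ‖² = ∫ |ψ|²`. -/
def normSq {n : ℕ} (ψ : Conf n → ℂ) : ℝ := ∫ x, ‖ψ x‖ ^ 2

/-- First moments `z_ψ = ⟨ψ|ẑ|ψ⟩ / ‖ψ‖²` (a real number, as `ẑ` is symmetric). -/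
def mean {n : ℕ} (hb : ℝ) (ψ : Conf n → ℂ) : Idx n → ℝ :=
  fun k => (scal ψ (zOp hb k ψ)).re / normSq ψ

/-- Centred second moments `Δ_ψ2`, `⟨ψ|Δẑ_j Δẑ_k + Δẑ_k Δẑ_j|ψ⟩ / (2‖ψ‖²)`. -/
def covar {n : ℕ} (hb : ℝ) (ψ : Conf n → ℂ) : Matrix (Idx n) (Idx n) ℝ :=
  Matrix.of fun j k =>
    (scal ψ (fun x => dzOp hb (mean hb ψ) j (dzOp hb (mean hb ψ) k ψ) x
      + dzOp hb (mean hb ψ) k (dzOp hb (mean hb ψ) j ψ) x)).re / (2 * normSq ψ)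

/-- Points `g = (z, Δ)` of the phase space of first and second moments. -/
abbrev Moments (n : ℕ) := (Idx n → ℝ) × Matrix (Idx n) (Idx n) ℝ

/-- `g₀(ψ) = ⟨ψ|ĝ|ψ⟩ / ‖ψ‖²`. -/
def moments {n : ℕ} (hb : ℝ) (ψ : Conf n → ℂ) : Moments n := (mean hb ψ, covar hb ψ)

/-! ### The quadratic Hamiltonian expanded about `z`; `κ` stands for `ϰ‖Ψ‖²` -/

/-- `𝔥_zz = H_zz + κ W_zz`. -/
def hzz {n : ℕ} (Q : Coeffs n) (κ t : ℝ) : Matrix (Idx n) (Idx n) ℝ := Q.Hzz t + κ • Q.Wzz t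

/-- `𝔥_z = H_z + (H_zz + κ W_zz + κ W_zw) z`. -/
def hz {n : ℕ} (Q : Coeffs n) (κ t : ℝ) (g : Moments n) : Idx n → ℝ :=
  Q.Hz t + (Q.Hzz t + κ • (Q.Wzz t + Q.Wzw t)) *ᵥ g.1

/-- `𝔥 = ½⟨z, [H_zz + κ(W_zz + 2W_zw + W_ww)] z⟩ + ⟨H_z, z⟩ + ½ κ Sp(W_ww Δ)`. -/
def h0 {n : ℕ} (Q : Coeffs n) (κ t : ℝ) (g : Moments n) : ℝ :=
  (1 / 2) * (g.1 ⬝ᵥ ((Q.Hzz t + κ • (Q.Wzz t + (2 : ℝ) • Q.Wzw t + Q.Www t)) *ᵥ g.1))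
    + Q.Hz t ⬝ᵥ g.1 + (1 / 2) * κ * (Q.Www t * g.2).trace

/-- The operator `𝔥 + ⟨𝔥_z, Δẑ⟩ + ½⟨Δẑ, 𝔥_zz Δẑ⟩`, with `Δẑ = ẑ - z`. -/
def hamiltonian {n : ℕ} (Q : Coeffs n) (hb κ t : ℝ) (g : Moments n) (f : Conf n → ℂ) :
    Conf n → ℂ := fun x =>
  (h0 Q κ t g : ℂ) * f x + ∑ k, (hz Q κ t g k : ℂ) * dzOp hb g.1 k f x
    + (1 / 2) * ∑ j, ∑ k, (hzz Q κ t j k : ℂ) * dzOp hb g.1 j (dzOp hb g.1 k f) x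

/-- `Ψ` solves the nonlocal Gross–Pitaevskii equation `{-iℏ ∂_t + 𝔥(t, Ψ(t))}Ψ = 0`. -/
def IsGPESolution {n : ℕ} (Q : Coeffs n) (hb ϰ : ℝ) (Ψ : ℝ → 𝓢(Conf n, ℂ)) : Prop :=
  ∀ (t : ℝ) (x : Conf n), DifferentiableAt ℝ (fun τ => Ψ τ x) t ∧
    -Complex.I * hb * deriv (fun τ => Ψ τ x) t
      + hamiltonian Q hb (ϰ * normSq (Ψ t)) t (moments hb (Ψ t)) (Ψ t) x = 0

/-! ### The Hamilton–Ehrenfest system and the system in variations -/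

/-- `ż = J{H_z + [H_zz + κ(W_zz + W_zw)] z}`, `Δ̇ = J 𝔥_zz Δ - Δ 𝔥_zz J`. -/
def IsHESSolution {n : ℕ} (Q : Coeffs n) (κ : ℝ) (g : ℝ → Moments n) : Prop :=
  ∀ t,
    (∀ k, HasDerivAt (fun τ => (g τ).1 k) ((sympJ n *ᵥ hz Q κ t (g t)) k) t) ∧
    ∀ j k, HasDerivAt (fun τ => (g τ).2 j k)
      ((sympJ n * hzz Q κ t * (g t).2 - (g t).2 * hzz Q κ t * sympJ n) j k) t

/-- The solution `t ↦ g(t, C)` of the Hamilton–Ehrenfest system with `g(s, C) = g₀`: the system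
is linear with continuous coefficients, so there is exactly one. -/
def hesFlow {n : ℕ} (Q : Coeffs n) (κ s : ℝ) (g₀ : Moments n) : ℝ → Moments n :=
  Classical.epsilon fun g => IsHESSolution Q κ g ∧ g s = g₀

/-- The matriciant `t ↦ A(t,s)`: the solution of `Ȧ = J 𝔥_zz A`, `A(s,s) = I`. -/
def matriciant {n : ℕ} (Q : Coeffs n) (κ t s : ℝ) : Matrix (Idx n) (Idx n) ℝ :=
  (Classical.epsilon fun A : ℝ → Matrix (Idx n) (Idx n) ℝ =>
    (∀ τ j k, HasDerivAt (fun u => A u j k) ((sympJ n * hzz Q κ τ * A τ) j k) τ) ∧ A s = 1) t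

/- The blocks `λ₁, …, λ₄` in `A(t,s) = (λ₄ᵀ, -λ₂ᵀ; -λ₃ᵀ, λ₁ᵀ)`. -/

def lam1 {n : ℕ} (Q : Coeffs n) (κ t s : ℝ) : Matrix (Fin n) (Fin n) ℝ :=
  (matriciant Q κ t s).toBlocks₂₂ᵀ

def lam2 {n : ℕ} (Q : Coeffs n) (κ t s : ℝ) : Matrix (Fin n) (Fin n) ℝ :=
  -(matriciant Q κ t s).toBlocks₁₂ᵀ

def lam3 {n : ℕ} (Q : Coeffs n) (κ t s : ℝ) : Matrix (Fin n) (Fin n) ℝ :=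
  -(matriciant Q κ t s).toBlocks₂₁ᵀ

def lam4 {n : ℕ} (Q : Coeffs n) (κ t s : ℝ) : Matrix (Fin n) (Fin n) ℝ :=
  (matriciant Q κ t s).toBlocks₁₁ᵀ

/-! ### The square root in the Green function

The Green function tends to `δ(x - y)` as `t → s` and depends continuously on time as a kernel.
This fixes the branch of `√det(-2πiℏ λ₃(t,s))`, also after zeros of `det λ₃`, as follows.
Let `e(x) = exp(-|x|²/2ℏ)` and let `U` be the integral operator with the centred
(`P = X = 0`, `S = 0`) kernel.  Then `⟨e|U e⟩ / ⟨e|e⟩ = 1 / √(f(t))` with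
`f(t) = det ½(λ₁ + λ₄ + i(λ₂ - λ₃))(t,s)`, `f(s) = 1`, which has no zeros; by continuity the root
of `f` is the continuous one equal to `1` at `t = s`.  On the other hand a Gaussian integration
over `(x,y)` gives `⟨e|U e⟩ / ⟨e|e⟩ = (4πℏ)^{n/2} / (√det(-2πiℏλ₃) · √det(1 + iN))`, where
`⟨(x,y), N (x,y)⟩` is minus twice the quadratic form in the phase. -/

/-- `f(t) = det ½(λ₁ + λ₄ + i(λ₂ - λ₃))`. -/
def overlapDet {n : ℕ} (Q : Coeffs n) (κ t s : ℝ) : ℂ :=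
  ((1 / 2 : ℂ) • ((lam1 Q κ t s + lam4 Q κ t s).map Complex.ofReal
    + Complex.I • (lam2 Q κ t s - lam3 Q κ t s).map Complex.ofReal)).det

/-- The square root of `f(t)` that is continuous in `t` and equals `1` at `t = s`. -/
def overlapSqrt {n : ℕ} (Q : Coeffs n) (κ t s : ℝ) : ℂ :=
  Complex.exp ((1 / 2) *
    ∫ τ in s..t, deriv (fun u => overlapDet Q κ u s) τ / overlapDet Q κ τ s)

/-- The square root of `det M` occurring in `∫ exp(-½⟨v, M v⟩) dv = (2π)^{k/2} / √det M` for a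
complex symmetric `k × k` matrix `M` with positive definite real part: the product of the
principal square roots of the eigenvalues. -/
def gaussSqrtDet {ι : Type} [Fintype ι] [DecidableEq ι] (M : Matrix ι ι ℂ) : ℂ :=
  (M.charpoly.roots.map fun w => w ^ (1 / 2 : ℂ)).prod

/-- The matrix `N = (λ₃⁻¹λ₄, -λ₃⁻¹; -λ₃⁻ᵀ, λ₁λ₃⁻¹)`. -/
def phaseMatrix {n : ℕ} (Q : Coeffs n) (κ t s : ℝ) : Matrix (Idx n) (Idx n) ℝ :=
  Matrix.fromBlocks ((lam3 Q κ t s)⁻¹ * lam4 Q κ t s) (-(lam3 Q κ t s)⁻¹)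
    (-((lam3 Q κ t s)⁻¹)ᵀ) (lam1 Q κ t s * (lam3 Q κ t s)⁻¹)

/-- The principal square root of `det(-2πiℏ λ₃(t,s))`. -/
def principalRoot {n : ℕ} (Q : Coeffs n) (hb κ t s : ℝ) : ℂ :=
  ((-Complex.I * 2 * Real.pi * hb) • (lam3 Q κ t s).map Complex.ofReal).det ^ (1 / 2 : ℂ)

/-- `√det(-2πiℏ λ₃(t,s))`, with the sign explained above: the quotient tested here is
`±(4πℏ)^{-n/2}`, and the sign has to be `+`. -/
def greenRoot {n : ℕ} (Q : Coeffs n) (hb κ t s : ℝ) : ℂ :=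
  open Classical in
  if 0 < (overlapSqrt Q κ t s / (principalRoot Q hb κ t s *
      gaussSqrtDet (1 + Complex.I • (phaseMatrix Q κ t s).map Complex.ofReal))).re
  then principalRoot Q hb κ t s else -principalRoot Q hb κ t s

/-! ### The Green function and the evolution operators -/

/-- The momentum component `P` of `g`. -/
def momP {n : ℕ} (g : Moments n) : Fin n → ℝ := fun j => g.1 (Sum.inl j)

/-- The position component `X` of `g`. -/
def posX {n : ℕ} (g : Moments n) : Fin n → ℝ := fun j => g.1 (Sum.inr j)

/-- The action `S(t) = ∫₀ᵗ {⟨P, Ẋ⟩ - 𝔥}` along a trajectory `g`. -/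
def action {n : ℕ} (Q : Coeffs n) (κ : ℝ) (g : ℝ → Moments n) (t : ℝ) : ℝ :=
  ∫ τ in (0 : ℝ)..t,
    ((∑ j, momP (g τ) j * deriv (fun u => posX (g u) j) τ) - h0 Q κ τ (g τ))

/-- The Green function `G(x, y, t, s, g(t), g(s))` along a trajectory `g`. -/
def green {n : ℕ} (Q : Coeffs n) (hb κ : ℝ) (g : ℝ → Moments n) (t s : ℝ) (x y : Conf n) : ℂ :=
  let dx : Fin n → ℝ := fun j => x j - posX (g t) j
  let dy : Fin n → ℝ := fun j => y j - posX (g s) j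
  (greenRoot Q hb κ t s)⁻¹ * Complex.exp (Complex.I / hb * ((
    action Q κ g t - action Q κ g s + momP (g t) ⬝ᵥ dx - momP (g s) ⬝ᵥ dy
      - (1 / 2) * (dy ⬝ᵥ ((lam1 Q κ t s * (lam3 Q κ t s)⁻¹) *ᵥ dy))
      + dx ⬝ᵥ ((lam3 Q κ t s)⁻¹ *ᵥ dy)
      - (1 / 2) * (dx ⬝ᵥ (((lam3 Q κ t s)⁻¹ * lam4 Q κ t s) *ᵥ dx)) : ℝ) : ℂ))

/-- The nonlinear evolution operator
`U(t, s, ψ)(x) = ∫ G(x, y, t, s, g(t, C(ψ)), g(s, C(ψ))) ψ(y) dy`, with `C(ψ)` given by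
`g(s, C) = g₀(ψ)`; for `t = s` the Green function is `δ(x - y)`. -/
def evol {n : ℕ} (Q : Coeffs n) (hb ϰ t s : ℝ) (ψ : Conf n → ℂ) : Conf n → ℂ :=
  open Classical in
  if t = s then ψ else fun x =>
    ∫ y, green Q hb (ϰ * normSq ψ) (hesFlow Q (ϰ * normSq ψ) s (moments hb ψ)) t s x y * ψ y

/-- The operator `U⁻¹(t, s, ψ)(x) = ∫ G(x, y, s, t, g(s, C(ψ)), g(t, C(ψ))) ψ(y) dy`; here `ψ` is
a state at time `t`, so `C(ψ)` is given by `g(t, C) = g₀(ψ)`. -/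
def evolInv {n : ℕ} (Q : Coeffs n) (hb ϰ t s : ℝ) (ψ : Conf n → ℂ) : Conf n → ℂ :=
  open Classical in
  if t = s then ψ else fun x =>
    ∫ y, green Q hb (ϰ * normSq ψ) (hesFlow Q (ϰ * normSq ψ) t (moments hb ψ)) s t x y * ψ y

end NonlocalGPE

end

/-! For a fixed trajectory the Green function is a constant times a unimodular exponential of a real
quadratic phase. Exchanging the two times, together with the two spatial arguments, negates the
phase (`green_swap_eq`). Hence the inverse operator is a chirp, times a Fourier transform in
rescaled frequencies, applied after another chirp. Plancherel makes it unitary (`scal_apply`), and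
Fourier inversion shows that the kernel with the opposite phase undoes it up to a constant
(`integral_conj_mul_apply`).

The nonlinear point is that the outer operator takes its coupling and its trajectory from the state
that the inner one produces. Unitarity keeps the norm, hence the coupling. Integration by parts in
the kernel shows that the shifted operators `Δẑ` are transformed by the real matrix `A(s,t)`
(`dzOp_apply`, `isMetaplectic_greenKernel`). So the mean of the new state is `z(s)` and its
covariance is `A Δ Aᵀ`, which is `Δ(s)` by `hesFlow_snd`. Uniqueness for the linear
Hamilton–Ehrenfest system then puts both operators on one trajectory (`hesFlow_hesFlow`).

The constant in the composition is 1 only if the two branches of the root match, that is, if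
`greenRoot` at `(s,t)` is the conjugate of its value at `(t,s)` (`greenRoot_swap`). The root is
determined by the continuous root of the overlap determinant and the Gaussian root of `det(1 + iN)`,
and both are conjugated when the times are exchanged. -/

noncomputable section

/-! ### Linear ordinary differential equations -/

section LinearODE

open MeasureTheory intervalIntegral Set Interval

variable {E : Type*} [NormedAddCommGroup E] [NormedSpace ℝ E]

/-- The terms of the Picard series of `x' = M x + b`, `x s = x₀`. -/
def picardTerm (M : ℝ → E →L[ℝ] E) (b : ℝ → E) (s : ℝ) (x₀ : E) : ℕ → ℝ → E
  | 0 => fun t => x₀ + ∫ τ in s..t, b τ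
  | k + 1 => fun t => ∫ τ in s..t, M τ (picardTerm M b s x₀ k τ)

variable {M : ℝ → E →L[ℝ] E} {b : ℝ → E} {s : ℝ} {x₀ : E}

theorem continuous_picardTerm [CompleteSpace E] (hM : Continuous M) (hb : Continuous b) (k : ℕ) :
    Continuous (picardTerm M b s x₀ k) := by
  induction k with
  | zero => exact continuous_const.add (continuous_primitive (fun _ _ => hb.intervalIntegrable _ _) _)
  | succ k ih =>
    exact continuous_primitive (fun _ _ => (hM.clm_apply ih).intervalIntegrable _ _) _

theorem hasDerivAt_picardTerm_zero [CompleteSpace E] (hb : Continuous b) (t : ℝ) :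
    HasDerivAt (picardTerm M b s x₀ 0) (b t) t :=
  (integral_hasDerivAt_right (hb.intervalIntegrable _ _)
    (hb.stronglyMeasurableAtFilter _ _) hb.continuousAt).const_add x₀

theorem hasDerivAt_picardTerm_succ [CompleteSpace E] (hM : Continuous M) (hb : Continuous b)
    (k : ℕ) (t : ℝ) :
    HasDerivAt (picardTerm M b s x₀ (k + 1)) (M t (picardTerm M b s x₀ k t)) t := by
  have h : Continuous fun τ => M τ (picardTerm M b s x₀ k τ) :=
    hM.clm_apply (continuous_picardTerm hM hb k)
  exact integral_hasDerivAt_right (h.intervalIntegrable _ _)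
    (h.stronglyMeasurableAtFilter _ _) h.continuousAt

/-- Each step costs a factor `C` and one integration of a power of `|τ - s|`, which builds up the
factorial. The interval is centred at `s` so that every integration path from `s` stays inside it.
-/
theorem norm_picardTerm_le {T B C : ℝ} (hC : ∀ t ∈ Icc (s - T) (s + T), ‖M t‖ ≤ C)
    (hB : ∀ t ∈ Icc (s - T) (s + T), ‖picardTerm M b s x₀ 0 t‖ ≤ B) (k : ℕ) :
    ∀ t ∈ Icc (s - T) (s + T),
      ‖picardTerm M b s x₀ k t‖ ≤ B * C ^ k * |t - s| ^ k / k.factorial := by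
  induction k with
  | zero => intro t ht; simpa using hB t ht
  | succ k ih =>
    intro t ht
    have hs : s ∈ Icc (s - T) (s + T) := by constructor <;> linarith [ht.1, ht.2]
    have hsub : Ι s t ⊆ Icc (s - T) (s + T) :=
      uIoc_subset_uIcc.trans (OrdConnected.uIcc_subset ordConnected_Icc hs ht)
    have hC0 : 0 ≤ C := (norm_nonneg _).trans (hC s hs)
    have hle : ∀ τ ∈ Ι s t, ‖M τ (picardTerm M b s x₀ k τ)‖
        ≤ C * (B * C ^ k * |τ - s| ^ k / k.factorial) := fun τ hτ =>
      ((M τ).le_opNorm _).trans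
        (mul_le_mul (hC τ (hsub hτ)) (ih τ (hsub hτ)) (norm_nonneg _) hC0)
    have hint : IntervalIntegrable
        (fun τ => C * (B * C ^ k * |τ - s| ^ k / k.factorial)) volume s t :=
      Continuous.intervalIntegrable (by fun_prop) _ _
    calc ‖∫ τ in s..t, M τ (picardTerm M b s x₀ k τ)‖
        ≤ |∫ τ in s..t, C * (B * C ^ k * |τ - s| ^ k / k.factorial)| :=
          norm_integral_le_abs_of_norm_le
            ((ae_restrict_iff' measurableSet_uIoc).2 (Filter.Eventually.of_forall hle)) hint
      _ = B * C ^ (k + 1) * |t - s| ^ (k + 1) / (k + 1).factorial := by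
          have h1 : ∀ τ : ℝ, C * (B * C ^ k * |τ - s| ^ k / k.factorial)
              = (B * C ^ (k + 1) / k.factorial) * |τ - s| ^ k := fun τ => by ring
          simp_rw [h1]
          have hB0 : 0 ≤ B := (norm_nonneg _).trans (hB s hs)
          rw [intervalIntegral.integral_const_mul, abs_mul, abs_intervalIntegral_eq,
            integral_pow_abs_sub_uIoc, Nat.factorial_succ, abs_of_nonneg (by positivity),
            abs_of_nonneg (by positivity)]
          push_cast
          field_simp

theorem exists_hasDerivAt_of_linear [CompleteSpace E] (hM : Continuous M) (hb : Continuous b)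
    (s : ℝ) (x₀ : E) :
    ∃ x : ℝ → E, x s = x₀ ∧ ∀ t, HasDerivAt x (M t (x t) + b t) t := by
  have key : ∀ T : ℝ, 0 < T → ∀ t ∈ Ioo (s - T) (s + T),
      Summable (fun k => picardTerm M b s x₀ k t) ∧
      HasDerivAt (fun t => ∑' k, picardTerm M b s x₀ k t)
        (M t (∑' k, picardTerm M b s x₀ k t) + b t) t := by
    intro T hT t ht
    obtain ⟨C, hC⟩ := isCompact_Icc.exists_bound_of_continuousOn
      (s := Icc (s - T) (s + T)) hM.continuousOn
    obtain ⟨B, hB⟩ := isCompact_Icc.exists_bound_of_continuousOn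
      (s := Icc (s - T) (s + T)) (continuous_picardTerm (x₀ := x₀) (s := s) hM hb 0).continuousOn
    have hs : s ∈ Icc (s - T) (s + T) := by constructor <;> linarith
    have hC0 : 0 ≤ C := (norm_nonneg _).trans (hC s hs)
    have hB0 : 0 ≤ B := (norm_nonneg _).trans (hB s hs)
    have hbd : ∀ k, ∀ t ∈ Icc (s - T) (s + T),
        ‖picardTerm M b s x₀ k t‖ ≤ B * ((C * T) ^ k / k.factorial) := by
      intro k t ht
      refine (norm_picardTerm_le hC hB k t ht).trans ?_
      have : |t - s| ≤ T := by rw [abs_le]; constructor <;> linarith [ht.1, ht.2]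
      rw [mul_assoc, ← mul_pow, mul_div_assoc]
      gcongr
    have hsum : Summable fun k : ℕ => B * ((C * T) ^ k / k.factorial) :=
      (Real.summable_pow_div_factorial _).mul_left B
    have hS : ∀ t ∈ Icc (s - T) (s + T), Summable fun k => picardTerm M b s x₀ k t :=
      fun t ht => Summable.of_norm_bounded hsum fun k => hbd k t ht
    have ht' := Ioo_subset_Icc_self ht
    refine ⟨hS t ht', ?_⟩
    -- The derivative of term `k + 1` is `M` applied to term `k`, so the differentiated tail is `M`
    -- applied to the whole series; term 0 contributes `b`.
    have hshift : HasDerivAt (fun t => ∑' k, picardTerm M b s x₀ (k + 1) t)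
        (∑' k, M t (picardTerm M b s x₀ k t)) t :=
      hasDerivAt_tsum_of_isPreconnected (hsum.mul_left C) isOpen_Ioo isPreconnected_Ioo
        (fun k y _ => hasDerivAt_picardTerm_succ hM hb k y)
        (fun k y hy => ((M y).le_opNorm _).trans (mul_le_mul (hC y (Ioo_subset_Icc_self hy))
            (hbd k y (Ioo_subset_Icc_self hy)) (norm_nonneg _) hC0))
        ht ((summable_nat_add_iff 1).2 (hS t ht')) ht
    rw [(M t).map_tsum (hS t ht'), add_comm]
    refine ((hasDerivAt_picardTerm_zero (M := M) (s := s) (x₀ := x₀) hb t).add hshift).congr_of_eventuallyEq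
      ?_
    filter_upwards [isOpen_Ioo.mem_nhds ht] with y hy
    exact (hS y (Ioo_subset_Icc_self hy)).tsum_eq_zero_add
  refine ⟨fun t => ∑' k, picardTerm M b s x₀ k t, ?_, fun t => ?_⟩
  · have h0 := (key 1 one_pos s (by constructor <;> linarith)).1
    simp only
    rw [h0.tsum_eq_zero_add]
    simp [picardTerm]
  · have : |t - s| < |t - s| + 1 := by linarith
    have h := abs_lt.1 this
    exact (key (|t - s| + 1) (by positivity) t (by constructor <;> linarith [h.1, h.2])).2

theorem eq_of_hasDerivAt_linear (hM : Continuous M) {x y : ℝ → E}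
    (hx : ∀ t, HasDerivAt x (M t (x t) + b t) t) (hy : ∀ t, HasDerivAt y (M t (y t) + b t) t)
    (h : x s = y s) : x = y := by
  funext t
  set T := |t - s| + 1
  have h1 := abs_lt.1 (show |t - s| < T by simp [T])
  have hT : 0 < T := by positivity
  obtain ⟨C, hC⟩ := isCompact_Icc.exists_bound_of_continuousOn
    (s := Icc (s - T) (s + T)) hM.continuousOn
  refine ODE_solution_unique_of_mem_Ioo (v := fun t x => M t x + b t) (s := fun _ => univ)
    (K := C.toNNReal) (a := s - T) (b := s + T) (t₀ := s) (fun τ hτ => ?_)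
    (by constructor <;> linarith)
    (fun τ _ => ⟨hx τ, mem_univ _⟩) (fun τ _ => ⟨hy τ, mem_univ _⟩) h
    (by constructor <;> linarith [h1.1, h1.2])
  refine LipschitzOnWith.of_dist_le' fun a _ b _ => ?_
  rw [dist_add_right, dist_eq_norm, dist_eq_norm, ← map_sub]
  exact ((M τ).le_opNorm _).trans
    (mul_le_mul_of_nonneg_right (hC τ (Ioo_subset_Icc_self hτ)) (norm_nonneg _))

/-- In finite dimension pointwise continuity of the coefficients already gives continuity in
operator norm. -/
theorem exists_unique_of_linear_finiteDimensional [FiniteDimensional ℝ E] (N : ℝ → E →ₗ[ℝ] E)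
    (hN : ∀ x, Continuous fun t => N t x) (hb : Continuous b) (s : ℝ) (x₀ : E) :
    (∃ x : ℝ → E, (∀ t, HasDerivAt x (N t (x t) + b t) t) ∧ x s = x₀) ∧
    ∀ x y : ℝ → E, (∀ t, HasDerivAt x (N t (x t) + b t) t) →
      (∀ t, HasDerivAt y (N t (y t) + b t) t) → x s = y s → x = y := by
  have : CompleteSpace E := FiniteDimensional.complete ℝ E
  have hM : Continuous fun t => LinearMap.toContinuousLinearMap (N t) :=
    continuous_clm_apply.2 fun x => by simpa using hN x
  refine ⟨?_, fun x y hx hy h => ?_⟩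
  · obtain ⟨x, h0, hx⟩ := exists_hasDerivAt_of_linear hM hb s x₀
    exact ⟨x, by simpa using hx, h0⟩
  · exact eq_of_hasDerivAt_linear hM (b := b) (by simpa using hx) (by simpa using hy) h

end LinearODE

/-! ### Matrix-valued functions differentiated entrywise -/

section MatDeriv

variable {l m n : Type*}

/-- The entries of `A` have derivatives at `t` the entries of `A'`. -/
def HasMatDerivAt (A : ℝ → Matrix m n ℝ) (A' : Matrix m n ℝ) (t : ℝ) : Prop :=
  ∀ j k, HasDerivAt (fun u => A u j k) (A' j k) t

theorem HasMatDerivAt.mul [Fintype m] {A : ℝ → Matrix l m ℝ} {B : ℝ → Matrix m n ℝ}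
    {A' : Matrix l m ℝ} {B' : Matrix m n ℝ} {t : ℝ} (hA : HasMatDerivAt A A' t)
    (hB : HasMatDerivAt B B' t) :
    HasMatDerivAt (fun u => A u * B u) (A' * B t + A t * B') t := by
  intro j k
  simp only [Matrix.mul_apply, Matrix.add_apply, ← Finset.sum_add_distrib]
  exact HasDerivAt.fun_sum fun i _ => (hA j i).mul (hB i k)

theorem hasMatDerivAt_const (A : Matrix m n ℝ) (t : ℝ) : HasMatDerivAt (fun _ => A) 0 t :=
  fun _ _ => hasDerivAt_const _ _

theorem HasMatDerivAt.mul_const [Fintype m] {A : ℝ → Matrix l m ℝ} {A' : Matrix l m ℝ} {t : ℝ}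
    (hA : HasMatDerivAt A A' t) (B : Matrix m n ℝ) :
    HasMatDerivAt (fun u => A u * B) (A' * B) t := by
  simpa using hA.mul (hasMatDerivAt_const B t)

theorem HasMatDerivAt.transpose {A : ℝ → Matrix m n ℝ} {A' : Matrix m n ℝ} {t : ℝ}
    (hA : HasMatDerivAt A A' t) : HasMatDerivAt (fun u => (A u)ᵀ) A'ᵀ t :=
  fun j k => hA k j

theorem HasMatDerivAt.continuous {A A' : ℝ → Matrix m n ℝ}
    (h : ∀ t, HasMatDerivAt A (A' t) t) : Continuous A :=
  continuous_matrix fun j k =>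
    continuous_iff_continuousAt.2 fun t => (h t j k).continuousAt

theorem HasMatDerivAt.eq_of_zero {A : ℝ → Matrix m n ℝ} (h : ∀ t, HasMatDerivAt A 0 t)
    (t s : ℝ) : A t = A s := by
  ext j k
  exact is_const_of_deriv_eq_zero (fun t => (h t j k).differentiableAt)
    (fun t => (h t j k).deriv) t s

theorem exists_unique_hasMatDerivAt_of_linear [Fintype m] [Fintype n]
    (N : ℝ → Matrix m n ℝ →ₗ[ℝ] Matrix m n ℝ) (hN : ∀ x, Continuous fun t => N t x) (s : ℝ)
    (x₀ : Matrix m n ℝ) :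
    (∃ A : ℝ → Matrix m n ℝ, (∀ t, HasMatDerivAt A (N t (A t)) t) ∧ A s = x₀) ∧
    ∀ A B : ℝ → Matrix m n ℝ, (∀ t, HasMatDerivAt A (N t (A t)) t) →
      (∀ t, HasMatDerivAt B (N t (B t)) t) → A s = B s → A = B := by
  -- Entrywise derivatives of matrices are derivatives in `m → n → ℝ` with its sup norm, so the
  -- vector-valued result applies.
  have key : ∀ (A : ℝ → m → n → ℝ) (A' : m → n → ℝ) (t : ℝ),
      HasDerivAt A A' t ↔ HasMatDerivAt A A' t := fun A A' t => by
    simp only [hasDerivAt_pi, HasMatDerivAt]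
  have h := exists_unique_of_linear_finiteDimensional (E := m → n → ℝ) (b := fun _ => 0) N hN
    continuous_const s x₀
  simp only [add_zero] at h
  refine ⟨?_, fun A B hA hB => h.2 A B (fun t => (key _ _ t).2 (hA t))
    (fun t => (key _ _ t).2 (hB t))⟩
  obtain ⟨A, hA, h0⟩ := h.1
  exact ⟨A, fun t => (key _ _ t).1 (hA t), h0⟩

end MatDeriv

/-! ### The matriciant: group law, symplecticity and block relations. -/

namespace NonlocalGPE

variable {n : ℕ} (Q : Coeffs n) (κ : ℝ)

theorem sympJ_mul_self : sympJ n * sympJ n = -1 := by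
  simp [sympJ, Matrix.fromBlocks_multiply, ← Matrix.fromBlocks_one, Matrix.fromBlocks_neg]

theorem sympJ_transpose : (sympJ n)ᵀ = -sympJ n := by
  simp [sympJ, Matrix.fromBlocks_transpose, Matrix.fromBlocks_neg]

theorem hzz_transpose (t : ℝ) : (hzz Q κ t)ᵀ = hzz Q κ t := by
  rw [hzz, Matrix.transpose_add, Matrix.transpose_smul, Q.symm_Hzz t, Q.symm_Wzz t]

theorem continuous_hzz : Continuous (hzz Q κ) :=
  Q.continuous_Hzz.add (Q.continuous_Wzz.const_smul κ)

theorem exists_unique_matriciant (s : ℝ) (x₀ : Matrix (Idx n) (Idx n) ℝ) :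
    (∃ A : ℝ → Matrix (Idx n) (Idx n) ℝ,
      (∀ t, HasMatDerivAt A (sympJ n * hzz Q κ t * A t) t) ∧ A s = x₀) ∧
    ∀ A B : ℝ → Matrix (Idx n) (Idx n) ℝ,
      (∀ t, HasMatDerivAt A (sympJ n * hzz Q κ t * A t) t) →
      (∀ t, HasMatDerivAt B (sympJ n * hzz Q κ t * B t) t) → A s = B s → A = B :=
  exists_unique_hasMatDerivAt_of_linear
    (fun t => LinearMap.mulLeft ℝ (sympJ n * hzz Q κ t))
    (fun _ => ((continuous_const.matrix_mul (continuous_hzz Q κ)).matrix_mul continuous_const))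
    s x₀

theorem matriciant_spec (s : ℝ) :
    (∀ t, HasMatDerivAt (fun u => matriciant Q κ u s)
      (sympJ n * hzz Q κ t * matriciant Q κ t s) t) ∧ matriciant Q κ s s = 1 :=
  Classical.epsilon_spec (exists_unique_matriciant Q κ s 1).1

theorem hasMatDerivAt_matriciant (s t : ℝ) :
    HasMatDerivAt (fun u => matriciant Q κ u s) (sympJ n * hzz Q κ t * matriciant Q κ t s) t :=
  (matriciant_spec Q κ s).1 t

@[simp] theorem matriciant_self (s : ℝ) : matriciant Q κ s s = 1 := (matriciant_spec Q κ s).2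

theorem continuous_matriciant (s : ℝ) : Continuous fun u => matriciant Q κ u s :=
  HasMatDerivAt.continuous (hasMatDerivAt_matriciant Q κ s)

/-- As functions of `u` both sides solve the same linear equation, and they agree at `u = t`. -/
theorem matriciant_mul_matriciant (u t s : ℝ) :
    matriciant Q κ u t * matriciant Q κ t s = matriciant Q κ u s := by
  have h := (exists_unique_matriciant Q κ t 1).2 (fun u => matriciant Q κ u t * matriciant Q κ t s)
    (fun u => matriciant Q κ u s)
    (fun τ => by
      simpa only [Matrix.mul_assoc] using (hasMatDerivAt_matriciant Q κ t τ).mul_const _)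
    (hasMatDerivAt_matriciant Q κ s) (by simp)
  exact congrFun h u

/-- The derivative of `Aᵀ J A` vanishes because `𝔥_zz` is symmetric, `Jᵀ = -J` and `J² = -1`. -/
theorem matriciant_symplectic (t s : ℝ) :
    (matriciant Q κ t s)ᵀ * sympJ n * matriciant Q κ t s = sympJ n := by
  have h : ∀ τ, HasMatDerivAt
      (fun u => (matriciant Q κ u s)ᵀ * sympJ n * matriciant Q κ u s) 0 τ := fun τ => by
    have hA := hasMatDerivAt_matriciant Q κ s τ
    have h2 := (hA.transpose.mul_const (sympJ n)).mul hA
    convert h2 using 1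
    simp only [Matrix.transpose_mul, hzz_transpose, sympJ_transpose, Matrix.mul_assoc]
    rw [← Matrix.mul_assoc (sympJ n) (sympJ n), ← Matrix.mul_assoc (-sympJ n) (sympJ n)]
    simp [sympJ_mul_self]
  simpa using HasMatDerivAt.eq_of_zero h t s

theorem matriciant_swap (t s : ℝ) :
    matriciant Q κ s t = -(sympJ n * (matriciant Q κ t s)ᵀ * sympJ n) := by
  have h1 : matriciant Q κ s t * matriciant Q κ t s = 1 := by
    rw [matriciant_mul_matriciant, matriciant_self]
  have h2 : -(sympJ n * (matriciant Q κ t s)ᵀ * sympJ n) * matriciant Q κ t s = 1 := by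
    rw [neg_mul, Matrix.mul_assoc, Matrix.mul_assoc, ← Matrix.mul_assoc _ (sympJ n),
      matriciant_symplectic, sympJ_mul_self, neg_neg]
  have h3 := mul_eq_one_comm.1 h1
  calc matriciant Q κ s t = -(sympJ n * (matriciant Q κ t s)ᵀ * sympJ n)
        * matriciant Q κ t s * matriciant Q κ s t := by rw [h2, one_mul]
    _ = _ := by rw [Matrix.mul_assoc _ (matriciant Q κ t s), h3, mul_one]

theorem matriciant_eq_fromBlocks (t s : ℝ) :
    matriciant Q κ t s = Matrix.fromBlocks (lam4 Q κ t s)ᵀ (-(lam2 Q κ t s)ᵀ)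
      (-(lam3 Q κ t s)ᵀ) (lam1 Q κ t s)ᵀ := by
  simp [lam1, lam2, lam3, lam4, Matrix.fromBlocks_toBlocks]

/-- The symplectic inverse `-J Aᵀ J` removes the transposes and signs from the blocks. This is the
matrix that later acts on `Δẑ`, and it yields all the rules for exchanging `t` and `s`. -/
theorem matriciant_swap_eq_fromBlocks (t s : ℝ) :
    matriciant Q κ s t = Matrix.fromBlocks (lam1 Q κ t s) (lam2 Q κ t s) (lam3 Q κ t s)
      (lam4 Q κ t s) := by
  rw [matriciant_swap, matriciant_eq_fromBlocks]
  simp [sympJ, Matrix.fromBlocks_multiply, Matrix.fromBlocks_transpose, Matrix.fromBlocks_neg]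

theorem lam1_swap (t s : ℝ) : lam1 Q κ s t = (lam4 Q κ t s)ᵀ := by
  rw [lam1, matriciant_swap_eq_fromBlocks, Matrix.toBlocks_fromBlocks₂₂]

theorem lam2_swap (t s : ℝ) : lam2 Q κ s t = -(lam2 Q κ t s)ᵀ := by
  rw [lam2, matriciant_swap_eq_fromBlocks, Matrix.toBlocks_fromBlocks₁₂]

theorem lam3_swap (t s : ℝ) : lam3 Q κ s t = -(lam3 Q κ t s)ᵀ := by
  rw [lam3, matriciant_swap_eq_fromBlocks, Matrix.toBlocks_fromBlocks₂₁]

theorem lam4_swap (t s : ℝ) : lam4 Q κ s t = (lam1 Q κ t s)ᵀ := by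
  rw [lam4, matriciant_swap_eq_fromBlocks, Matrix.toBlocks_fromBlocks₁₁]

/-- `A(s,t) A(t,s) = 1` in blocks. -/
theorem lam_relations (t s : ℝ) :
    lam1 Q κ t s * (lam4 Q κ t s)ᵀ - lam2 Q κ t s * (lam3 Q κ t s)ᵀ = 1 ∧
    lam2 Q κ t s * (lam1 Q κ t s)ᵀ = lam1 Q κ t s * (lam2 Q κ t s)ᵀ ∧
    lam4 Q κ t s * (lam3 Q κ t s)ᵀ = lam3 Q κ t s * (lam4 Q κ t s)ᵀ := by
  have h : matriciant Q κ s t * matriciant Q κ t s = 1 := by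
    rw [matriciant_mul_matriciant, matriciant_self]
  rw [matriciant_swap_eq_fromBlocks, matriciant_eq_fromBlocks, Matrix.fromBlocks_multiply,
    ← Matrix.fromBlocks_one, Matrix.fromBlocks_inj] at h
  obtain ⟨h1, h2, h3, -⟩ := h
  refine ⟨?_, ?_, ?_⟩
  · rw [← h1]; simp [sub_eq_add_neg]
  · rw [Matrix.mul_neg, neg_add_eq_zero] at h2; exact h2.symm
  · rw [Matrix.mul_neg, add_neg_eq_zero] at h3; exact h3.symm

/-- `A(t,s) A(s,t) = 1` in blocks. -/
theorem lam_relations' (t s : ℝ) :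
    (lam1 Q κ t s)ᵀ * lam4 Q κ t s - (lam3 Q κ t s)ᵀ * lam2 Q κ t s = 1 ∧
    (lam4 Q κ t s)ᵀ * lam2 Q κ t s = (lam2 Q κ t s)ᵀ * lam4 Q κ t s ∧
    (lam1 Q κ t s)ᵀ * lam3 Q κ t s = (lam3 Q κ t s)ᵀ * lam1 Q κ t s := by
  have h : matriciant Q κ t s * matriciant Q κ s t = 1 := by
    rw [matriciant_mul_matriciant, matriciant_self]
  rw [matriciant_eq_fromBlocks Q κ t s, matriciant_swap_eq_fromBlocks Q κ t s,
    Matrix.fromBlocks_multiply, ← Matrix.fromBlocks_one, Matrix.fromBlocks_inj] at h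
  obtain ⟨-, h2, h3, h4⟩ := h
  refine ⟨?_, ?_, ?_⟩
  · rw [← h4]; simp [sub_eq_add_neg, add_comm]
  · rw [Matrix.neg_mul, add_neg_eq_zero] at h2; exact h2
  · rw [Matrix.neg_mul, neg_add_eq_zero] at h3; exact h3.symm

/-! ### The Hamilton–Ehrenfest system -/

/-- The system decouples: the equation for `z` is affine and does not involve `Δ`, and the one for
`Δ` is linear. -/
theorem isHESSolution_iff {g : ℝ → Moments n} : IsHESSolution Q κ g ↔
    (∀ t, HasDerivAt (fun τ => (g τ).1)
      ((Matrix.mulVecLin (sympJ n * (Q.Hzz t + κ • (Q.Wzz t + Q.Wzw t)))) (g t).1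
        + sympJ n *ᵥ Q.Hz t) t) ∧
    ∀ t, HasMatDerivAt (fun τ => (g τ).2)
      ((LinearMap.mulLeft ℝ (sympJ n * hzz Q κ t) - LinearMap.mulRight ℝ (hzz Q κ t * sympJ n))
        (g t).2) t := by
  rw [← forall_and]
  refine forall_congr' fun t => and_congr ?_ ?_
  · rw [hasDerivAt_pi]
    simp only [hz, Matrix.mulVec_add, Matrix.mulVecLin_apply, Matrix.mulVec_mulVec, add_comm]
  · simp [HasMatDerivAt, Matrix.mul_assoc]

theorem exists_isHESSolution (s : ℝ) (g₀ : Moments n) :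
    ∃ g, IsHESSolution Q κ g ∧ g s = g₀ := by
  obtain ⟨z, hz, hz0⟩ := (exists_unique_of_linear_finiteDimensional (E := Idx n → ℝ)
    (fun t => Matrix.mulVecLin (sympJ n * (Q.Hzz t + κ • (Q.Wzz t + Q.Wzw t))))
    (b := fun t => sympJ n *ᵥ Q.Hz t) (fun x => by
      have := Q.continuous_Hzz; have := Q.continuous_Wzz; have := Q.continuous_Wzw
      simp only [Matrix.mulVecLin_apply]
      fun_prop) (by have := Q.continuous_Hz; fun_prop) s g₀.1).1
  obtain ⟨D, hD, hD0⟩ := (exists_unique_hasMatDerivAt_of_linear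
    (fun t => LinearMap.mulLeft ℝ (sympJ n * hzz Q κ t)
      - LinearMap.mulRight ℝ (hzz Q κ t * sympJ n)) (fun x => by
      have := continuous_hzz Q κ
      simp only [LinearMap.sub_apply, LinearMap.mulLeft_apply, LinearMap.mulRight_apply]
      fun_prop) s g₀.2).1
  exact ⟨fun t => (z t, D t), (isHESSolution_iff Q κ).2 ⟨hz, hD⟩, Prod.ext hz0 hD0⟩

theorem IsHESSolution.eq_of_eq {g h : ℝ → Moments n} (hg : IsHESSolution Q κ g)
    (hh : IsHESSolution Q κ h) {s : ℝ} (hs : g s = h s) : g = h := by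
  rw [isHESSolution_iff] at hg hh
  have h1 := (exists_unique_of_linear_finiteDimensional (E := Idx n → ℝ)
    (fun t => Matrix.mulVecLin (sympJ n * (Q.Hzz t + κ • (Q.Wzz t + Q.Wzw t))))
    (b := fun t => sympJ n *ᵥ Q.Hz t) (fun x => by
      have := Q.continuous_Hzz; have := Q.continuous_Wzz; have := Q.continuous_Wzw
      simp only [Matrix.mulVecLin_apply]
      fun_prop) (by have := Q.continuous_Hz; fun_prop) s 0).2 _ _ hg.1 hh.1 (by simp [hs])
  have h2 := (exists_unique_hasMatDerivAt_of_linear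
    (fun t => LinearMap.mulLeft ℝ (sympJ n * hzz Q κ t)
      - LinearMap.mulRight ℝ (hzz Q κ t * sympJ n)) (fun x => by
      have := continuous_hzz Q κ
      simp only [LinearMap.sub_apply, LinearMap.mulLeft_apply, LinearMap.mulRight_apply]
      fun_prop) s 0).2 _ _ hg.2 hh.2 (by simp [hs])
  funext t
  exact Prod.ext (congrFun h1 t) (congrFun h2 t)

theorem hesFlow_spec (s : ℝ) (g₀ : Moments n) :
    IsHESSolution Q κ (hesFlow Q κ s g₀) ∧ hesFlow Q κ s g₀ s = g₀ :=
  Classical.epsilon_spec (exists_isHESSolution Q κ s g₀)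

theorem hesFlow_hesFlow (t s : ℝ) (g₀ : Moments n) :
    hesFlow Q κ s (hesFlow Q κ t g₀ s) = hesFlow Q κ t g₀ :=
  IsHESSolution.eq_of_eq Q κ (hesFlow_spec Q κ s _).1 (hesFlow_spec Q κ t _).1
    (hesFlow_spec Q κ s _).2

/-- The right-hand side solves the covariance equation by the product rule; uniqueness identifies it
with the flow. -/
theorem hesFlow_snd (t s : ℝ) (g₀ : Moments n) :
    (hesFlow Q κ s g₀ t).2 = matriciant Q κ t s * g₀.2 * (matriciant Q κ t s)ᵀ := by
  have h0 := hesFlow_spec Q κ s g₀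
  have h : IsHESSolution Q κ fun t =>
      ((hesFlow Q κ s g₀ t).1, matriciant Q κ t s * g₀.2 * (matriciant Q κ t s)ᵀ) := by
    refine (isHESSolution_iff Q κ).2 ⟨((isHESSolution_iff Q κ).1 h0.1).1, fun τ => ?_⟩
    have hA := hasMatDerivAt_matriciant Q κ s τ
    convert (hA.mul_const g₀.2).mul hA.transpose using 1
    simp [Matrix.transpose_mul, hzz_transpose, sympJ_transpose, Matrix.mul_assoc, sub_eq_add_neg]
  have h1 := h0.1.eq_of_eq Q κ h (s := s) (by rw [h0.2]; simp)
  exact congrArg Prod.snd (congrFun h1 t)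

end NonlocalGPE

/-! ### Complex square roots of the determinants in the Green function -/

section Matrices

open scoped ComplexOrder

theorem Matrix.det_ne_zero_of_conjTranspose_mul_self {m : Type*} [Fintype m] [DecidableEq m]
    {L R : Matrix m m ℂ} {c : ℂ} (hc : 0 < c) (h : Lᴴ * L = c • (1 : Matrix m m ℂ) + Rᴴ * R) :
    L.det ≠ 0 := by
  have hp : (Lᴴ * L).PosDef := by
    rw [h]
    exact (Matrix.PosDef.one.smul hc).add_posSemidef (Matrix.posSemidef_conjTranspose_mul_self R)
  have := hp.det_pos.ne'
  rw [Matrix.det_mul] at this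
  exact right_ne_zero_of_mul this

theorem Matrix.det_fromBlocks_zero_one_neg_one_zero {m : Type*} [Fintype m] [DecidableEq m]
    {R : Type*} [CommRing R] :
    (Matrix.fromBlocks 0 1 (-1) 0 : Matrix (m ⊕ m) (m ⊕ m) R).det = 1 := by
  have h : (Matrix.fromBlocks 0 1 (-1) 0 : Matrix (m ⊕ m) (m ⊕ m) R)
      = Matrix.fromBlocks 1 1 0 1 * Matrix.fromBlocks 1 0 (-1) 1 * Matrix.fromBlocks 1 1 0 1 := by
    simp [Matrix.fromBlocks_multiply]
  rw [h, Matrix.det_mul, Matrix.det_mul, Matrix.det_fromBlocks_zero₂₁,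
    Matrix.det_fromBlocks_zero₁₂]
  simp

theorem Matrix.conjTranspose_map_ofReal {l m : Type*} (A : Matrix l m ℝ) :
    (A.map Complex.ofReal)ᴴ = Aᵀ.map Complex.ofReal := by
  ext; simp

theorem Matrix.map_ofReal_mul {l m k : Type*} [Fintype m] (A : Matrix l m ℝ) (B : Matrix m k ℝ) :
    (A * B).map Complex.ofReal = A.map Complex.ofReal * B.map Complex.ofReal :=
  Matrix.map_mul (f := Complex.ofRealHom)

theorem Matrix.map_ofReal_add {l m : Type*} (A B : Matrix l m ℝ) :
    (A + B).map Complex.ofReal = A.map Complex.ofReal + B.map Complex.ofReal := by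
  ext; simp

theorem Matrix.map_ofReal_sub {l m : Type*} (A B : Matrix l m ℝ) :
    (A - B).map Complex.ofReal = A.map Complex.ofReal - B.map Complex.ofReal := by
  ext; simp

theorem Matrix.map_ofReal_one {m : Type*} [DecidableEq m] :
    (1 : Matrix m m ℝ).map Complex.ofReal = 1 := by
  simp

/-- A complexified symplectic matrix has an invertible complex-linear part. -/
theorem Matrix.det_ne_zero_of_symplectic {m : Type*} [Fintype m] [DecidableEq m]
    {a b c d : Matrix m m ℝ} (h1 : aᵀ * d - cᵀ * b = 1) (h2 : dᵀ * b = bᵀ * d)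
    (h3 : aᵀ * c = cᵀ * a) :
    ((a + d).map Complex.ofReal + Complex.I • (b - c).map Complex.ofReal).det ≠ 0 := by
  have h4 : dᵀ * a - bᵀ * c = 1 := by simpa using congrArg Matrix.transpose h1
  -- `R` is the antilinear counterpart of the linear part `L`, and the symplectic relations amount
  -- to the Bogoliubov-type identity `LᴴL - RᴴR = 4`.
  refine Matrix.det_ne_zero_of_conjTranspose_mul_self (c := 4)
    (R := (d - a).map Complex.ofReal - Complex.I • (b + c).map Complex.ofReal) (by norm_num) ?_
  have g1 := congrArg (fun M => Matrix.map M Complex.ofReal) h1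
  have g2 := congrArg (fun M => Matrix.map M Complex.ofReal) h2
  have g3 := congrArg (fun M => Matrix.map M Complex.ofReal) h3
  have g4 := congrArg (fun M => Matrix.map M Complex.ofReal) h4
  simp only [map_ofReal_mul, map_ofReal_sub, map_ofReal_one] at g1 g2 g3 g4
  simp only [Matrix.conjTranspose_add, Matrix.conjTranspose_sub, Matrix.conjTranspose_smul,
    conjTranspose_map_ofReal, map_ofReal_add, map_ofReal_sub, 
    add_mul, sub_mul, mul_add, mul_sub, smul_mul_assoc, mul_smul_comm,
    Complex.star_def, Complex.conj_I]
  linear_combination (norm := (match_scalars <;> ring_nf <;> norm_num [Complex.I_sq])) (2 : ℂ) • g1 + (2 : ℂ) • g4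
    + (2 * Complex.I) • g2 - (2 * Complex.I) • g3

theorem Matrix.det_add_I_smul_ne_zero {m : Type*} [Fintype m] [DecidableEq m]
    {N : Matrix m m ℝ} (hN : N.IsSymm) {c : ℝ} (hc : c ≠ 0) :
    ((c : ℂ) • (1 : Matrix m m ℂ) + Complex.I • N.map Complex.ofReal).det ≠ 0 := by
  refine Matrix.det_ne_zero_of_conjTranspose_mul_self (c := ((c ^ 2 : ℝ) : ℂ))
    (R := N.map Complex.ofReal) (Complex.zero_lt_real.2 (by positivity)) ?_
  simp only [Matrix.conjTranspose_add, Matrix.conjTranspose_smul,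
    conjTranspose_map_ofReal, hN.eq, add_mul, mul_add, smul_mul_assoc, mul_smul_comm,
    Complex.star_def, Complex.conj_I, Matrix.conjTranspose_one, one_mul, mul_one, Complex.conj_ofReal]
  push_cast
  match_scalars <;> ring_nf
  norm_num [Complex.I_sq]

end Matrices

/-! ### Continuous square roots of nonvanishing functions of two times. -/

section ContinuousSqrt

variable {F : ℝ → ℝ → ℂ}

/-- The square root of `F · s` continued from the value `1` at `s`. -/
def continuedSqrt (F : ℝ → ℝ → ℂ) (t s : ℝ) : ℂ :=
  Complex.exp ((1 / 2) * ∫ τ in s..t, deriv (fun u => F u s) τ / F τ s)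

theorem hasDerivAt_left_of_contDiff (hF : ContDiff ℝ 1 fun p : ℝ × ℝ => F p.1 p.2) (t s : ℝ) :
    HasDerivAt (fun u => F u s) (fderiv ℝ (fun p : ℝ × ℝ => F p.1 p.2) (t, s) (1, 0)) t := by
  have h := (hF.differentiable one_ne_zero (t, s)).hasFDerivAt
  exact h.comp_hasDerivAt t ((hasDerivAt_id t).prodMk (hasDerivAt_const t s))

theorem continuous_logDeriv_of_contDiff (hF : ContDiff ℝ 1 fun p : ℝ × ℝ => F p.1 p.2)
    (h0 : ∀ t s, F t s ≠ 0) :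
    Continuous fun p : ℝ × ℝ => deriv (fun u => F u p.1) p.2 / F p.2 p.1 := by
  simp only [fun t s => (hasDerivAt_left_of_contDiff hF t s).deriv]
  refine Continuous.div ?_ ?_ fun p => h0 _ _
  · exact ((hF.continuous_fderiv one_ne_zero).comp continuous_swap).clm_apply continuous_const
  · exact hF.continuous.comp continuous_swap

theorem continuous_logDeriv_left_of_contDiff (hF : ContDiff ℝ 1 fun p : ℝ × ℝ => F p.1 p.2)
    (h0 : ∀ t s, F t s ≠ 0) (s : ℝ) :
    Continuous fun τ => deriv (fun u => F u s) τ / F τ s :=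
  (continuous_logDeriv_of_contDiff hF h0).comp (Continuous.prodMk_right s)

theorem continuous_continuedSqrt_left (hF : ContDiff ℝ 1 fun p : ℝ × ℝ => F p.1 p.2)
    (h0 : ∀ t s, F t s ≠ 0) (s : ℝ) : Continuous fun t => continuedSqrt F t s := by
  have := intervalIntegral.continuous_primitive (μ := MeasureTheory.volume)
    (fun a b => (continuous_logDeriv_left_of_contDiff hF h0 s).intervalIntegrable a b) s
  exact Complex.continuous_exp.comp (continuous_const.mul this)

/-- Here both the base point and the integrand vary. Continuity in the base point is what allows the
root to be compared with its time-exchanged version as functions of one variable. -/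
theorem continuous_continuedSqrt_right (hF : ContDiff ℝ 1 fun p : ℝ × ℝ => F p.1 p.2)
    (h0 : ∀ t s, F t s ≠ 0) (s : ℝ) : Continuous fun t => continuedSqrt F s t := by
  have h := intervalIntegral.continuous_parametric_intervalIntegral_of_continuous
    (μ := MeasureTheory.volume) (a₀ := s)
    (f := fun t τ => deriv (fun u => F u t) τ / F τ t)
    (continuous_logDeriv_of_contDiff hF h0) continuous_id
  simp only [continuedSqrt, fun t => intervalIntegral.integral_symm (μ := MeasureTheory.volume)
    (f := fun τ => deriv (fun u => F u t) τ / F τ t) s t]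
  exact Complex.continuous_exp.comp (continuous_const.mul h.neg)

theorem continuedSqrt_self (F : ℝ → ℝ → ℂ) (s : ℝ) : continuedSqrt F s s = 1 := by
  simp [continuedSqrt]

/-- With `G` the integral of the logarithmic derivative, `F · exp(-G)` has zero derivative and
equals 1 at `s`. -/
theorem continuedSqrt_sq (hF : ContDiff ℝ 1 fun p : ℝ × ℝ => F p.1 p.2)
    (h0 : ∀ t s, F t s ≠ 0) (h1 : ∀ s, F s s = 1) (t s : ℝ) :
    continuedSqrt F t s ^ 2 = F t s := by
  set G : ℝ → ℂ := fun t => ∫ τ in s..t, deriv (fun u => F u s) τ / F τ s with hG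
  have h2 := continuous_logDeriv_left_of_contDiff hF h0 s
  have hG' : ∀ t, HasDerivAt G (deriv (fun u => F u s) t / F t s) t := fun t =>
    intervalIntegral.integral_hasDerivAt_right (h2.intervalIntegrable _ _)
      (h2.stronglyMeasurableAtFilter _ _) h2.continuousAt
  have hc : ∀ t, HasDerivAt (fun t => F t s * Complex.exp (-G t)) 0 t := fun t => by
    have h3 := (hasDerivAt_left_of_contDiff hF t s).differentiableAt.hasDerivAt.mul
      (hG' t).neg.cexp
    refine h3.congr_deriv ?_
    have := h0 t s
    field_simp
    ring
  have h4 := is_const_of_deriv_eq_zero (fun t => (hc t).differentiableAt)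
    (fun t => (hc t).deriv) t s
  have h5 : G s = 0 := by simp [hG]
  simp only [h5, h1, neg_zero, Complex.exp_zero, mul_one] at h4
  have h6 : continuedSqrt F t s ^ 2 = Complex.exp (G t) := by
    rw [continuedSqrt, ← Complex.exp_nat_mul]
    congr 1
    push_cast
    ring
  rw [h6]
  rw [Complex.exp_neg] at h4
  exact ((mul_inv_eq_one₀ (Complex.exp_ne_zero _)).1 h4).symm

/-- Both sides are continuous in `t`, have the same nonvanishing square and agree at `t = s`; on the
connected line they coincide. -/
theorem continuedSqrt_swap (hF : ContDiff ℝ 1 fun p : ℝ × ℝ => F p.1 p.2)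
    (h0 : ∀ t s, F t s ≠ 0) (h1 : ∀ s, F s s = 1)
    (hs : ∀ t s, F s t = starRingEnd ℂ (F t s)) (t s : ℝ) :
    continuedSqrt F s t = starRingEnd ℂ (continuedSqrt F t s) := by
  have hc : Continuous fun t => starRingEnd ℂ (continuedSqrt F t s) :=
    Complex.continuous_conj.comp (continuous_continuedSqrt_left hF h0 s)
  refine isPreconnected_univ.eq_of_sq_eq (continuous_continuedSqrt_right hF h0 s).continuousOn
    hc.continuousOn (fun u _ => ?_) (fun {u} _ => ?_) (Set.mem_univ s) ?_ (Set.mem_univ t)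
  · simp only [Pi.pow_apply]
    rw [continuedSqrt_sq hF h0 h1, hs, ← map_pow, continuedSqrt_sq hF h0 h1]
  · rw [Ne, map_eq_zero]
    intro h
    have := continuedSqrt_sq hF h0 h1 u s
    rw [h, zero_pow two_ne_zero] at this
    exact h0 u s this.symm
  · simp [continuedSqrt_self]

end ContinuousSqrt

/-! ### The Gaussian root and the overlap determinant. -/

namespace NonlocalGPE

section GaussSqrtDet

variable {ι : Type} [Fintype ι] [DecidableEq ι]

theorem sqrt_sq (w : ℂ) : (w ^ (1 / 2 : ℂ)) ^ 2 = w := by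
  simp

theorem gaussSqrtDet_sq (M : Matrix ι ι ℂ) : gaussSqrtDet M ^ 2 = M.det := by
  rw [gaussSqrtDet, ← Multiset.prod_map_pow, Matrix.det_eq_prod_roots_charpoly]
  simp

theorem gaussSqrtDet_reindex {ι' : Type} [Fintype ι'] [DecidableEq ι'] (e : ι ≃ ι')
    (M : Matrix ι ι ℂ) : gaussSqrtDet (Matrix.reindex e e M) = gaussSqrtDet M := by
  rw [gaussSqrtDet, gaussSqrtDet, Matrix.charpoly_reindex]

theorem gaussSqrtDet_map_conj (M : Matrix ι ι ℂ) (hM : ∀ w ∈ M.charpoly.roots, w.arg ≠ Real.pi) :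
    gaussSqrtDet (M.map (starRingEnd ℂ)) = starRingEnd ℂ (gaussSqrtDet M) := by
  have h1 : (M.charpoly.map (starRingEnd ℂ)).roots = M.charpoly.roots.map (starRingEnd ℂ) :=
    (IsAlgClosed.splits M.charpoly).roots_map _
  rw [gaussSqrtDet, gaussSqrtDet, Matrix.charpoly_map, h1, Multiset.map_map, map_multiset_prod,
    Multiset.map_map]
  refine congrArg _ (Multiset.map_congr rfl fun w hw => ?_)
  simp only [Function.comp]
  rw [Complex.conj_cpow _ _ (hM w hw)]
  simp [map_ofNat]

/-- A negative real eigenvalue `w` would make `(1 - w) + iN` singular, although its real part is a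
positive scalar. This keeps the eigenvalues off the cut, where the principal root does not commute
with conjugation. -/
theorem arg_ne_pi_of_mem_roots {N : Matrix ι ι ℝ} (hN : N.IsSymm) {w : ℂ}
    (hw : w ∈ (1 + Complex.I • N.map Complex.ofReal).charpoly.roots) : w.arg ≠ Real.pi := by
  intro h
  obtain ⟨h1, h2⟩ := Complex.arg_eq_pi_iff.1 h
  have hw' : w = (w.re : ℂ) := Complex.ext rfl (by simpa using h2)
  have h0 := Polynomial.isRoot_of_mem_roots hw
  rw [Polynomial.IsRoot, Matrix.eval_charpoly] at h0
  refine Matrix.det_add_I_smul_ne_zero hN (c := 1 - w.re) (by linarith) ?_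
  have : ((1 - w.re : ℝ) : ℂ) • (1 : Matrix ι ι ℂ) + Complex.I • N.map Complex.ofReal
      = -(Matrix.scalar ι w - (1 + Complex.I • N.map Complex.ofReal)) := by
    rw [Matrix.scalar_apply, ← Matrix.smul_one_eq_diagonal]
    conv_rhs => rw [hw']
    push_cast
    module
  rw [this, Matrix.det_neg, h0, mul_zero]

end GaussSqrtDet

variable {n : ℕ} (Q : Coeffs n) (κ : ℝ)

theorem overlapDet_ne_zero (t s : ℝ) : overlapDet Q κ t s ≠ 0 := by
  obtain ⟨h1, h2, h3⟩ := lam_relations' Q κ t s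
  rw [overlapDet, Matrix.det_smul]
  exact mul_ne_zero (pow_ne_zero _ (by norm_num)) (Matrix.det_ne_zero_of_symplectic h1 h2 h3)

theorem overlapDet_self (s : ℝ) : overlapDet Q κ s s = 1 := by
  have h : matriciant Q κ s s = Matrix.fromBlocks 1 0 0 1 := by simp
  have h2 : (1 / 2 : ℂ) • (1 + 1 : Matrix (Fin n) (Fin n) ℂ) = 1 := by module
  simp only [overlapDet, lam1, lam2, lam3, lam4, h, Matrix.toBlocks_fromBlocks₁₁,
    Matrix.toBlocks_fromBlocks₁₂, Matrix.toBlocks_fromBlocks₂₁, Matrix.toBlocks_fromBlocks₂₂,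
    Matrix.transpose_zero, Matrix.transpose_one, neg_zero, sub_zero, Matrix.map_ofReal_add,
    Matrix.map_ofReal_one, Matrix.map_zero _ Complex.ofReal_zero, smul_zero, add_zero, h2,
    Matrix.det_one]

/-- Exchanging the times replaces the matrix under the determinant by its conjugate transpose. -/
theorem overlapDet_swap (t s : ℝ) : overlapDet Q κ s t = starRingEnd ℂ (overlapDet Q κ t s) := by
  rw [overlapDet, overlapDet, ← Complex.star_def, ← Matrix.det_conjTranspose, lam1_swap Q κ t s,
    lam2_swap Q κ t s, lam3_swap Q κ t s, lam4_swap Q κ t s]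
  congr 1
  ext j k
  simp
  ring

theorem contDiff_matriciant_left (s : ℝ) (j k : Idx n) :
    ContDiff ℝ 1 fun u => matriciant Q κ u s j k := by
  have h := fun t => hasMatDerivAt_matriciant Q κ s t j k
  rw [contDiff_one_iff_deriv]
  refine ⟨fun t => (h t).differentiableAt, ?_⟩
  rw [funext fun t => (h t).deriv]
  have := continuous_hzz Q κ
  have := continuous_matriciant Q κ s
  exact Continuous.matrix_elem (by fun_prop) j k

/-- Factoring through time 0 and inverting symplectically makes the entries polynomial in the
entries of `A(t,0)` and `A(s,0)`. -/
theorem contDiff_matriciant (j k : Idx n) :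
    ContDiff ℝ 1 fun p : ℝ × ℝ => matriciant Q κ p.1 p.2 j k := by
  have h : ∀ p : ℝ × ℝ, matriciant Q κ p.1 p.2 j k
      = ∑ i, matriciant Q κ p.1 0 j i * matriciant Q κ 0 p.2 i k := fun p => by
    rw [← matriciant_mul_matriciant Q κ p.1 0 p.2, Matrix.mul_apply]
  simp only [h, fun u => matriciant_swap Q κ u 0, Matrix.neg_apply, Matrix.mul_apply,
    Matrix.transpose_apply]
  have h1 : ∀ j k, ContDiff ℝ 1 fun p : ℝ × ℝ => matriciant Q κ p.1 0 j k := fun j k =>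
    (contDiff_matriciant_left Q κ 0 j k).comp contDiff_fst
  have h2 : ∀ j k, ContDiff ℝ 1 fun p : ℝ × ℝ => matriciant Q κ p.2 0 j k := fun j k =>
    (contDiff_matriciant_left Q κ 0 j k).comp contDiff_snd
  fun_prop

theorem contDiff_overlapDet : ContDiff ℝ 1 fun p : ℝ × ℝ => overlapDet Q κ p.1 p.2 := by
  have h : ∀ j k, ContDiff ℝ 1 fun p : ℝ × ℝ => (matriciant Q κ p.1 p.2 j k : ℂ) := fun j k =>
    Complex.ofRealCLM.contDiff.comp (contDiff_matriciant Q κ j k)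
  simp only [overlapDet, Matrix.det_apply, lam1, lam2, lam3, lam4, Matrix.smul_apply,
    Matrix.add_apply, Matrix.map_apply, Matrix.sub_apply, Matrix.neg_apply,
    Matrix.transpose_apply, Matrix.toBlocks₁₁, Matrix.toBlocks₁₂, Matrix.toBlocks₂₁,
    Matrix.toBlocks₂₂, Matrix.of_apply, smul_eq_mul]
  push_cast
  refine ContDiff.sum fun σ _ => ContDiff.const_smul _ (contDiff_prod fun i _ => ?_)
  fun_prop

theorem overlapSqrt_sq (t s : ℝ) : overlapSqrt Q κ t s ^ 2 = overlapDet Q κ t s :=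
  continuedSqrt_sq (contDiff_overlapDet Q κ) (overlapDet_ne_zero Q κ) (overlapDet_self Q κ) t s

theorem overlapSqrt_swap (t s : ℝ) :
    overlapSqrt Q κ s t = starRingEnd ℂ (overlapSqrt Q κ t s) :=
  continuedSqrt_swap (contDiff_overlapDet Q κ) (overlapDet_ne_zero Q κ) (overlapDet_self Q κ)
    (overlapDet_swap Q κ) t s

end NonlocalGPE

/-! ### The phase matrix and the branch of the Green root. -/

theorem Complex.im_eq_zero_of_sq_eq_ofReal {q : ℂ} {r : ℝ} (hr : 0 ≤ r) (h : q ^ 2 = r) :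
    q.im = 0 := by
  have h1 := congrArg Complex.re h
  have h2 := congrArg Complex.im h
  simp only [sq, Complex.mul_re, Complex.mul_im, Complex.ofReal_re, Complex.ofReal_im] at h1 h2
  rcases mul_eq_zero.1 (show q.re * q.im = 0 by linarith) with h3 | h3
  · nlinarith [mul_self_nonneg q.im]
  · exact h3

namespace NonlocalGPE

variable {n : ℕ} (Q : Coeffs n) (κ : ℝ)

section

variable {Q κ} {t s : ℝ}

theorem det_lam3_swap_ne_zero (h : (lam3 Q κ t s).det ≠ 0) : (lam3 Q κ s t).det ≠ 0 := by
  rw [lam3_swap, Matrix.det_neg, Matrix.det_transpose]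
  exact mul_ne_zero (pow_ne_zero _ (by norm_num)) h

theorem lam1_mul_inv_isSymm (h : (lam3 Q κ t s).det ≠ 0) :
    (lam1 Q κ t s * (lam3 Q κ t s)⁻¹).IsSymm := by
  have hu : IsUnit (lam3 Q κ t s).det := h.isUnit
  have h3 := (lam_relations' Q κ t s).2.2
  have hut : IsUnit (lam3 Q κ t s)ᵀ.det := by rwa [Matrix.det_transpose]
  rw [Matrix.IsSymm, Matrix.transpose_mul, Matrix.transpose_nonsing_inv]
  calc (lam3 Q κ t s)ᵀ⁻¹ * (lam1 Q κ t s)ᵀ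
      = (lam3 Q κ t s)ᵀ⁻¹ * ((lam1 Q κ t s)ᵀ * lam3 Q κ t s) * (lam3 Q κ t s)⁻¹ := by
        rw [Matrix.mul_assoc, Matrix.mul_nonsing_inv_cancel_right _ _ hu]
    _ = _ := by rw [h3, Matrix.nonsing_inv_mul_cancel_left _ _ hut]

theorem inv_mul_lam4_isSymm (h : (lam3 Q κ t s).det ≠ 0) :
    ((lam3 Q κ t s)⁻¹ * lam4 Q κ t s).IsSymm := by
  have hu : IsUnit (lam3 Q κ t s).det := h.isUnit
  have h3 := (lam_relations Q κ t s).2.2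
  have hut : IsUnit (lam3 Q κ t s)ᵀ.det := by rwa [Matrix.det_transpose]
  rw [Matrix.IsSymm, Matrix.transpose_mul, Matrix.transpose_nonsing_inv]
  calc (lam4 Q κ t s)ᵀ * (lam3 Q κ t s)ᵀ⁻¹
      = (lam3 Q κ t s)⁻¹ * (lam3 Q κ t s * (lam4 Q κ t s)ᵀ) * (lam3 Q κ t s)ᵀ⁻¹ := by
        rw [Matrix.nonsing_inv_mul_cancel_left _ _ hu]
    _ = _ := by rw [← h3, Matrix.mul_assoc, Matrix.mul_nonsing_inv_cancel_right _ _ hut]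

/-- Symmetry turns `λ₁λ₃⁻¹` into `λ₃⁻ᵀλ₁ᵀ`, and then `λ₁ᵀλ₄ = 1 + λ₃ᵀλ₂` applies. -/
theorem lam1_mul_inv_mul_lam4 (h : (lam3 Q κ t s).det ≠ 0) :
    lam1 Q κ t s * (lam3 Q κ t s)⁻¹ * lam4 Q κ t s
      = ((lam3 Q κ t s)⁻¹)ᵀ + lam2 Q κ t s := by
  have hut : IsUnit (lam3 Q κ t s)ᵀ.det := by
    rw [Matrix.det_transpose]; exact h.isUnit
  have h1 := (lam_relations' Q κ t s).1
  rw [← (lam1_mul_inv_isSymm h).eq, Matrix.transpose_mul, Matrix.mul_assoc,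
    sub_eq_iff_eq_add.1 h1, mul_add, mul_one, Matrix.transpose_nonsing_inv,
    Matrix.nonsing_inv_mul_cancel_left _ _ hut]

theorem phaseMatrix_isSymm (h : (lam3 Q κ t s).det ≠ 0) : (phaseMatrix Q κ t s).IsSymm := by
  rw [Matrix.IsSymm, phaseMatrix, Matrix.fromBlocks_transpose, (lam1_mul_inv_isSymm h).eq,
    (inv_mul_lam4_isSymm h).eq]
  simp

theorem phaseMatrix_swap (h : (lam3 Q κ t s).det ≠ 0) :
    phaseMatrix Q κ s t
      = -Matrix.reindex (Equiv.sumComm _ _) (Equiv.sumComm _ _) (phaseMatrix Q κ t s) := by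
  have hneg : (lam3 Q κ s t)⁻¹ = -((lam3 Q κ t s)⁻¹)ᵀ := by
    rw [lam3_swap, Matrix.transpose_nonsing_inv]
    refine Matrix.inv_eq_left_inv ?_
    rw [neg_mul_neg]
    exact Matrix.nonsing_inv_mul _ (by rw [Matrix.det_transpose]; exact h.isUnit)
  have h1 := (lam1_mul_inv_isSymm h).eq
  have h4 := (inv_mul_lam4_isSymm h).eq
  rw [Matrix.transpose_mul] at h1 h4
  rw [phaseMatrix, phaseMatrix, hneg, lam1_swap Q κ t s, lam4_swap Q κ t s]
  simp only [Matrix.reindex_apply, Equiv.sumComm_symm]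
  rw [show ⇑(Equiv.sumComm (Fin n) (Fin n)) = Sum.swap from rfl,
    Matrix.fromBlocks_submatrix_sum_swap_sum_swap, Matrix.fromBlocks_neg, Matrix.neg_mul,
    Matrix.mul_neg, h1, h4]
  simp

theorem det_one_add_phaseMatrix (h : (lam3 Q κ t s).det ≠ 0) :
    (1 + Complex.I • (phaseMatrix Q κ t s).map Complex.ofReal).det
      * ((lam3 Q κ t s).map Complex.ofReal).det
      = Complex.I ^ n * 2 ^ n * overlapDet Q κ t s := by
  have hu : IsUnit (lam3 Q κ t s).det := h.isUnit
  have g1 := congrArg (fun M => Matrix.map M Complex.ofReal) (lam1_mul_inv_mul_lam4 h)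
  have g2 := congrArg (fun M => Matrix.map M Complex.ofReal) (Matrix.nonsing_inv_mul _ hu)
  simp only [Matrix.map_ofReal_mul, Matrix.map_ofReal_add, Matrix.map_ofReal_one] at g1 g2
  rw [overlapDet, phaseMatrix]
  simp only [Matrix.map_ofReal_add, Matrix.map_ofReal_sub]
  have hN : (Matrix.fromBlocks ((lam3 Q κ t s)⁻¹ * lam4 Q κ t s) (-(lam3 Q κ t s)⁻¹)
      (-((lam3 Q κ t s)⁻¹)ᵀ) (lam1 Q κ t s * (lam3 Q κ t s)⁻¹)).map Complex.ofReal
      = Matrix.fromBlocks (((lam3 Q κ t s)⁻¹).map Complex.ofReal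
          * (lam4 Q κ t s).map Complex.ofReal)
        (-((lam3 Q κ t s)⁻¹).map Complex.ofReal) (-((lam3 Q κ t s)⁻¹)ᵀ.map Complex.ofReal)
        ((lam1 Q κ t s).map Complex.ofReal * ((lam3 Q κ t s)⁻¹).map Complex.ofReal) := by
    rw [Matrix.fromBlocks_map, Matrix.map_ofReal_mul, Matrix.map_ofReal_mul]
    congr 1 <;> ext <;> simp
  rw [hN]
  generalize (lam1 Q κ t s).map Complex.ofReal = a at *
  generalize (lam2 Q κ t s).map Complex.ofReal = b at *
  generalize (lam3 Q κ t s).map Complex.ofReal = c at *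
  generalize (lam4 Q κ t s).map Complex.ofReal = d at *
  generalize ((lam3 Q κ t s)⁻¹).map Complex.ofReal = l at *
  generalize ((lam3 Q κ t s)⁻¹)ᵀ.map Complex.ofReal = l' at *
  -- Column operations of determinant 1 bring `1 + iN` to block triangular form, with the overlap
  -- matrix, up to the factor ½, in a diagonal block.
  have hM : (1 + Complex.I • Matrix.fromBlocks (l * d) (-l) (-l') (a * l))
        * (Matrix.fromBlocks 1 0 (d - Complex.I • c) 1 * Matrix.fromBlocks 0 1 (-1) 0)
      = Matrix.fromBlocks (Complex.I • l) 0 (-(1 + Complex.I • (a * l)))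
        (a + d + Complex.I • (b - c)) := by
    rw [← Matrix.fromBlocks_one, Matrix.fromBlocks_smul, Matrix.fromBlocks_add,
      Matrix.fromBlocks_multiply, Matrix.fromBlocks_multiply]
    congr 1
    · simp
    · simp only [zero_add, mul_sub, mul_zero, mul_one, Matrix.mul_smul, smul_mul_assoc,
        smul_neg, neg_mul, g2, add_zero]
      match_scalars <;> ring_nf
      norm_num [Complex.I_sq]
    · simp
    · have g3 : a * l * c = a := by rw [Matrix.mul_assoc, g2, mul_one]
      simp only [zero_add, mul_sub, mul_zero, mul_one, Matrix.mul_smul, smul_mul_assoc,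
        add_mul, one_mul, smul_neg, g1, g3, add_zero]
      match_scalars <;> ring_nf
      norm_num [Complex.I_sq]
  have hdet := congrArg Matrix.det hM
  rw [Matrix.det_mul, Matrix.det_mul, Matrix.det_fromBlocks_zero₁₂,
    Matrix.det_fromBlocks_zero_one_neg_one_zero, Matrix.det_fromBlocks_zero₁₂] at hdet
  simp only [Matrix.det_one, mul_one] at hdet
  have hdl : l.det * c.det = 1 := by rw [← Matrix.det_mul, g2, Matrix.det_one]
  rw [hdet, Matrix.det_smul, Matrix.det_smul, Fintype.card_fin]
  have h2 : (2 : ℂ) ^ n * (1 / 2) ^ n = 1 := by rw [← mul_pow]; norm_num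
  linear_combination (Complex.I ^ n * (a + d + Complex.I • (b - c)).det) * hdl
    - (Complex.I ^ n * (a + d + Complex.I • (b - c)).det) * h2

theorem gaussSqrtDet_phaseMatrix_swap (h : (lam3 Q κ t s).det ≠ 0) :
    gaussSqrtDet (1 + Complex.I • (phaseMatrix Q κ s t).map Complex.ofReal)
      = starRingEnd ℂ (gaussSqrtDet (1 + Complex.I • (phaseMatrix Q κ t s).map Complex.ofReal)) := by
  rw [← gaussSqrtDet_map_conj _ fun w hw => arg_ne_pi_of_mem_roots (phaseMatrix_isSymm h) hw,
    ← gaussSqrtDet_reindex (Equiv.sumComm (Fin n) (Fin n)), phaseMatrix_swap h]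
  congr 1
  ext j k
  rcases j with j | j <;> rcases k with k | k <;>
    simp [Matrix.one_apply]

theorem principalRoot_sq (hb : ℝ) : principalRoot Q hb κ t s ^ 2
    = (-Complex.I * 2 * Real.pi * hb) ^ n * ((lam3 Q κ t s).map Complex.ofReal).det := by
  rw [principalRoot, sqrt_sq, Matrix.det_smul, Fintype.card_fin]

theorem det_map_ofReal_ne_zero (h : (lam3 Q κ t s).det ≠ 0) :
    ((lam3 Q κ t s).map Complex.ofReal).det ≠ 0 := by
  have : ((lam3 Q κ t s).map Complex.ofReal).det = ((lam3 Q κ t s).det : ℂ) :=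
    (RingHom.map_det Complex.ofRealHom _).symm
  rw [this]
  exact_mod_cast h

/-- The sign in `greenRoot` makes it the quotient of the continuous root and the Gaussian one. -/
theorem overlapSqrt_eq_mul_greenRoot {hb : ℝ} (hhb : 0 < hb) (h : (lam3 Q κ t s).det ≠ 0) :
    (Real.sqrt ((4 * Real.pi * hb) ^ n) : ℂ) * overlapSqrt Q κ t s = greenRoot Q hb κ t s *
      gaussSqrtDet (1 + Complex.I • (phaseMatrix Q κ t s).map Complex.ofReal) := by
  have hpos : 0 < (4 * Real.pi * hb) ^ n := by positivity
  have hc := det_map_ofReal_ne_zero h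
  have hf := overlapDet_ne_zero Q κ t s
  have hp := principalRoot_sq (Q := Q) (κ := κ) (t := t) (s := s) hb
  have hg := gaussSqrtDet_sq (1 + Complex.I • (phaseMatrix Q κ t s).map Complex.ofReal)
  have ho := overlapSqrt_sq Q κ t s
  have hd := det_one_add_phaseMatrix h
  rw [greenRoot]
  generalize principalRoot Q hb κ t s = p at *
  generalize gaussSqrtDet (1 + Complex.I • (phaseMatrix Q κ t s).map Complex.ofReal) = g at *
  generalize overlapSqrt Q κ t s = o at *
  rw [← hg] at hd
  have hpg : p ^ 2 * g ^ 2 = ((4 * Real.pi * hb) ^ n : ℝ) * o ^ 2 := by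
    have hI : (-Complex.I * 2 * Real.pi * hb) ^ n * (Complex.I ^ n * 2 ^ n)
        = ((4 * Real.pi * hb) ^ n : ℝ) := by
      rw [← mul_pow, ← mul_pow]
      push_cast
      congr 1
      linear_combination (-4 * (Real.pi : ℂ) * hb) * Complex.I_sq
    rw [hp, ho, ← hI]
    linear_combination (-Complex.I * 2 * Real.pi * hb) ^ n * hd
  have ho0 : o ≠ 0 := fun h0 => hf (by rw [← ho, h0]; simp)
  have hpg0 : p * g ≠ 0 := by
    intro h0
    have : p ^ 2 * g ^ 2 = 0 := by rw [← mul_pow, h0]; simp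
    rw [this] at hpg
    exact mul_ne_zero (Complex.ofReal_ne_zero.2 hpos.ne') (pow_ne_zero 2 ho0) hpg.symm
  -- By `hpg`, `q²` is the positive number `(4πℏ)⁻ⁿ`, so `q` is real and has one of two values. The
  -- test in `greenRoot` reads off its sign.
  set q := o / (p * g) with hq
  have hoq : o = q * (p * g) := by rw [hq, div_mul_cancel₀ _ hpg0]
  have hq2 : ((4 * Real.pi * hb) ^ n : ℝ) * q ^ 2 = 1 := by
    have : (p * g) ^ 2 * (((4 * Real.pi * hb) ^ n : ℝ) * q ^ 2) = (p * g) ^ 2 * 1 := by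
      linear_combination -hpg - ((4 * Real.pi * hb) ^ n : ℝ) * (o + q * (p * g)) * hoq
    exact mul_left_cancel₀ (pow_ne_zero 2 hpg0) this
  have him : q.im = 0 := Complex.im_eq_zero_of_sq_eq_ofReal
    (r := ((4 * Real.pi * hb) ^ n)⁻¹) (by positivity) (by
      rw [Complex.ofReal_inv]
      exact (eq_inv_of_mul_eq_one_right hq2))
  have hqr : q = (q.re : ℂ) := Complex.ext rfl (by simpa using him)
  set S := Real.sqrt ((4 * Real.pi * hb) ^ n) with hS
  have hS0 : 0 < S := Real.sqrt_pos.2 hpos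
  have hSq : (S * q.re) ^ 2 = 1 := by
    rw [hqr] at hq2
    rw [mul_pow, hS, Real.sq_sqrt hpos.le]
    exact_mod_cast hq2
  rw [hoq]
  split_ifs with hsgn
  · have : S * q.re = 1 := by
      rcases mul_self_eq_one_iff.1 ((sq _).symm.trans hSq) with h1 | h1
      · exact h1
      · nlinarith
    have hc : (S : ℂ) * q = 1 := by rw [hqr]; exact_mod_cast this
    linear_combination (p * g) * hc
  · have : S * q.re = -1 := by
      rcases mul_self_eq_one_iff.1 ((sq _).symm.trans hSq) with h1 | h1
      · nlinarith
      · exact h1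
    have hc : (S : ℂ) * q = -1 := by rw [hqr]; exact_mod_cast this
    linear_combination (p * g) * hc

/-- Principal roots alone need not be conjugate, since the determinant may be a negative real. The
relation is therefore read off from the other two factors in `overlapSqrt_eq_mul_greenRoot`. -/
theorem greenRoot_swap {hb : ℝ} (hhb : 0 < hb) (h : (lam3 Q κ t s).det ≠ 0) :
    greenRoot Q hb κ s t = starRingEnd ℂ (greenRoot Q hb κ t s) := by
  have h1 := overlapSqrt_eq_mul_greenRoot hhb h
  have h2 := overlapSqrt_eq_mul_greenRoot hhb (det_lam3_swap_ne_zero h)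
  rw [overlapSqrt_swap, gaussSqrtDet_phaseMatrix_swap h] at h2
  have h3 := congrArg (starRingEnd ℂ) h1
  rw [map_mul, map_mul, Complex.conj_ofReal, h2] at h3
  refine mul_right_cancel₀ ?_ h3
  rw [Ne, map_eq_zero]
  intro h0
  have hg := gaussSqrtDet_sq (1 + Complex.I • (phaseMatrix Q κ t s).map Complex.ofReal)
  have hd := det_one_add_phaseMatrix h
  rw [← hg, h0] at hd
  have : Complex.I ^ n * 2 ^ n * overlapDet Q κ t s ≠ 0 :=
    mul_ne_zero (mul_ne_zero (pow_ne_zero _ Complex.I_ne_zero) (pow_ne_zero _ two_ne_zero))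
      (overlapDet_ne_zero Q κ t s)
  exact this (by rw [← hd]; simp)

theorem norm_sq_greenRoot {hb : ℝ} (hhb : 0 < hb) :
    ‖greenRoot Q hb κ t s‖ ^ 2 = (2 * Real.pi * hb) ^ n * |(lam3 Q κ t s).det| := by
  have h1 : greenRoot Q hb κ t s ^ 2 = principalRoot Q hb κ t s ^ 2 := by
    rw [greenRoot]; split_ifs <;> simp
  have h2 : ((lam3 Q κ t s).map Complex.ofReal).det = ((lam3 Q κ t s).det : ℂ) :=
    (RingHom.map_det Complex.ofRealHom _).symm
  rw [← norm_pow, h1, principalRoot_sq, h2]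
  simp [abs_of_pos Real.pi_pos, abs_of_pos hhb]

theorem greenRoot_mul_swap {hb : ℝ} (hhb : 0 < hb) (h : (lam3 Q κ t s).det ≠ 0) :
    greenRoot Q hb κ t s * greenRoot Q hb κ s t
      = ((2 * Real.pi * hb) ^ n * |(lam3 Q κ t s).det| : ℝ) := by
  rw [greenRoot_swap hhb h, Complex.mul_conj, Complex.normSq_eq_norm_sq, norm_sq_greenRoot hhb]

end

end NonlocalGPE

/-! ### Quadratic phases -/

/-- All derivatives have modulus 1. This is what makes multiplication by a chirp preserve Schwartz
functions. -/
theorem hasTemperateGrowth_cexp_mul_I :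
    Function.HasTemperateGrowth fun r : ℝ => Complex.exp (r * Complex.I) := by
  have hd : ∀ r : ℝ, HasDerivAt (fun r : ℝ => Complex.exp (r * Complex.I))
      (Complex.I * Complex.exp (r * Complex.I)) r := fun r => by
    have := ((Complex.ofRealCLM.hasDerivAt (x := r)).mul_const Complex.I).cexp
    simpa [mul_comm] using this
  have hi : ∀ k, iteratedDeriv k (fun r : ℝ => Complex.exp (r * Complex.I))
      = fun r : ℝ => Complex.I ^ k * Complex.exp (r * Complex.I) := by
    intro k
    induction k with
    | zero => simp
    | succ k ih =>
      rw [iteratedDeriv_succ, ih]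
      funext r
      rw [((hd r).const_mul _).deriv, pow_succ, mul_assoc]
  refine ⟨Complex.contDiff_exp.comp (Complex.ofRealCLM.contDiff.mul contDiff_const), fun k => ⟨0, 1, fun r => ?_⟩⟩
  rw [norm_iteratedFDeriv_eq_norm_iteratedDeriv, hi]
  simp [Complex.norm_exp_ofReal_mul_I]

/-- The integral is the Fourier transform at 0, where the factor produced by the derivative
vanishes. It serves as integration by parts. -/
theorem SchwartzMap.integral_lineDerivOp_eq_zero {V : Type*} [NormedAddCommGroup V]
    [InnerProductSpace ℝ V] [FiniteDimensional ℝ V] [MeasurableSpace V] [BorelSpace V]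
    (f : 𝓢(V, ℂ)) (v : V) : ∫ x, LineDeriv.lineDerivOp v f x = 0 := by
  have h := DFunLike.congr_fun (SchwartzMap.fourier_lineDerivOp_eq f v) 0
  rw [SchwartzMap.fourier_coe, Real.fourier_eq'] at h
  have hg : (fun x : V => inner ℝ x v).HasTemperateGrowth := by fun_prop
  simpa [SchwartzMap.smulLeftCLM_apply_apply hg] using h

theorem integral_comp_toEuclideanLin {n : ℕ} {M : Matrix (Fin n) (Fin n) ℝ} (hM : M.det ≠ 0)
    (Y : EuclideanSpace ℝ (Fin n)) (F : EuclideanSpace ℝ (Fin n) → ℂ) :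
    ∫ y, F (Matrix.toEuclideanLin M (y - Y)) = (|M.det|⁻¹ : ℝ) * ∫ w, F w := by
  have hd : LinearMap.det (Matrix.toEuclideanLin M) = M.det := by
    simp only [Matrix.toEuclideanLin]
    rw [Matrix.toLpLin_eq_toLin, LinearMap.det_toLin]
  have hd0 : LinearMap.det (Matrix.toEuclideanLin M) ≠ 0 := by rwa [hd]
  rw [MeasureTheory.integral_sub_right_eq_self (fun y => F (Matrix.toEuclideanLin M y))]
  let e := (LinearMap.equivOfDetNeZero _ hd0).toContinuousLinearEquiv
  have h := MeasureTheory.Measure.map_linearMap_addHaar_eq_smul_addHaar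
    (MeasureTheory.volume : MeasureTheory.Measure (EuclideanSpace ℝ (Fin n))) hd0
  have h1 : ∫ y, F (Matrix.toEuclideanLin M y)
      = ∫ w, F w ∂MeasureTheory.Measure.map e.toHomeomorph MeasureTheory.volume :=
    (e.toHomeomorph.measurableEmbedding.integral_map F).symm
  have h2 : MeasureTheory.Measure.map e.toHomeomorph MeasureTheory.volume
      = ENNReal.ofReal |(LinearMap.det (Matrix.toEuclideanLin M))⁻¹| •
        (MeasureTheory.volume : MeasureTheory.Measure (EuclideanSpace ℝ (Fin n))) := h
  rw [h1, h2, MeasureTheory.integral_smul_measure, ENNReal.toReal_ofReal (abs_nonneg _), hd, abs_inv,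
    Complex.real_smul]

namespace NonlocalGPE

variable {n : ℕ}

/-- The quadratic polynomial `c + ⟨p, x - X⟩ - ½⟨x - X, M (x - X)⟩`. -/
def quad (c : ℝ) (p : Fin n → ℝ) (M : Matrix (Fin n) (Fin n) ℝ) (X : Fin n → ℝ) (x : Conf n) : ℝ :=
  c + p ⬝ᵥ (x.ofLp - X) - 1 / 2 * ((x.ofLp - X) ⬝ᵥ (M *ᵥ (x.ofLp - X)))

/-- The phase factor `exp(-i/ℏ (c + ⟨p, x - X⟩ - ½⟨x - X, M (x - X)⟩))`. -/
def chirp (hb c : ℝ) (p : Fin n → ℝ) (M : Matrix (Fin n) (Fin n) ℝ) (X : Fin n → ℝ)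
    (x : Conf n) : ℂ :=
  Complex.exp (-(Complex.I / hb * quad c p M X x))

variable (hb c : ℝ) (p : Fin n → ℝ) (M : Matrix (Fin n) (Fin n) ℝ) (X : Fin n → ℝ)

theorem hasTemperateGrowth_coord (j : Fin n) :
    Function.HasTemperateGrowth fun x : Conf n => x j :=
  (EuclideanSpace.proj (𝕜 := ℝ) j).hasTemperateGrowth

theorem hasTemperateGrowth_coord_ofReal (j : Fin n) :
    Function.HasTemperateGrowth fun x : Conf n => (x j : ℂ) :=
  Function.HasTemperateGrowth.comp Complex.ofRealCLM.hasTemperateGrowth (hasTemperateGrowth_coord j)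

theorem hasTemperateGrowth_quad : Function.HasTemperateGrowth (quad c p M X) := by
  have h := fun j => hasTemperateGrowth_coord (n := n) j
  unfold quad
  simp only [dotProduct, Matrix.mulVec, Pi.sub_apply]
  fun_prop

theorem hasTemperateGrowth_chirp : Function.HasTemperateGrowth (chirp hb c p M X) := by
  have h : chirp hb c p M X
      = (fun r : ℝ => Complex.exp (r * Complex.I)) ∘ fun x => (-(1 / hb)) * quad c p M X x := by
    funext x
    simp only [chirp, Function.comp]
    congr 1
    push_cast
    ring
  have h2 := hasTemperateGrowth_quad c p M X
  rw [h]
  exact hasTemperateGrowth_cexp_mul_I.comp (by fun_prop)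

theorem norm_chirp (x : Conf n) : ‖chirp hb c p M X x‖ = 1 := by
  have : -(Complex.I / hb * quad c p M X x) = ((-(1 / hb * quad c p M X x) : ℝ) : ℂ) * Complex.I := by
    push_cast; ring
  rw [chirp, this, Complex.norm_exp_ofReal_mul_I]

theorem differentiable_chirp : Differentiable ℝ (chirp hb c p M X) :=
  (hasTemperateGrowth_chirp hb c p M X).1.differentiable (by simp)

variable {M} in
theorem quad_add_smul_single (hM : M.IsSymm) (x : Conf n) (k : Fin n) (r : ℝ) :
    quad c p M X (x + r • EuclideanSpace.single k 1)
      = quad c p M X x + r * (p k - (M *ᵥ (x.ofLp - X)) k) - 1 / 2 * r ^ 2 * M k k := by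
  have h : (x + r • EuclideanSpace.single k (1 : ℝ)).ofLp - X
      = (x.ofLp - X) + r • Pi.single k 1 := by
    ext j; simp; ring
  have h2 : (x.ofLp - X) ⬝ᵥ M.col k = (M *ᵥ (x.ofLp - X)) k := by
    rw [dotProduct_comm]
    conv_rhs => rw [← hM.eq]
    rfl
  rw [quad, quad, h]
  generalize x.ofLp - X = d at *
  simp only [Matrix.mulVec_add, Matrix.mulVec_smul, dotProduct_add, add_dotProduct,
    smul_dotProduct, dotProduct_smul, single_one_dotProduct, dotProduct_single_one,
    Matrix.mulVec_single_one, smul_eq_mul, h2, Matrix.col_apply]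
  ring

variable {M} in
theorem fderiv_chirp (hM : M.IsSymm) (x : Conf n) (k : Fin n) :
    fderiv ℝ (chirp hb c p M X) x (EuclideanSpace.single k 1)
      = -(Complex.I / hb) * ((p k - (M *ᵥ (x.ofLp - X)) k : ℝ) : ℂ) * chirp hb c p M X x := by
  rw [← (differentiable_chirp hb c p M X x).lineDeriv_eq_fderiv, lineDeriv]
  simp only [chirp, quad_add_smul_single c p X hM]
  set q := p k - (M *ᵥ (x.ofLp - X)) k
  have h1 : HasDerivAt (fun r : ℝ => quad c p M X x + r * q - 1 / 2 * r ^ 2 * M k k) q 0 := by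
    refine ((((hasDerivAt_id (0 : ℝ)).mul_const q).const_add (quad c p M X x)).sub
      ((((hasDerivAt_id (0 : ℝ)).pow 2).const_mul (1 / 2)).mul_const (M k k))).congr_deriv ?_
    simp
  have h2 : HasDerivAt (fun r : ℝ => Complex.exp (-(Complex.I / hb
      * ((quad c p M X x + r * q - 1 / 2 * r ^ 2 * M k k : ℝ) : ℂ)))) _ 0 :=
    ((h1.ofReal_comp.const_mul (Complex.I / hb)).neg).cexp
  rw [h2.deriv]
  simp
  ring

end NonlocalGPE

namespace NonlocalGPE

open FourierTransform

/-! ### Integral operators with quadratic phase -/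

/-- The data of a kernel `C exp(-i φ(x,y)/ℏ)` with
`φ = S + ⟨P, x - X⟩ - ⟨R, y - Y⟩ - ½⟨y - Y, b(y - Y)⟩ + ⟨x - X, l(y - Y)⟩ - ½⟨x - X, a(x - X)⟩`. -/
structure QuadKernel (n : ℕ) where
  C : ℂ
  S : ℝ
  P : Fin n → ℝ
  R : Fin n → ℝ
  X : Fin n → ℝ
  Y : Fin n → ℝ
  a : Matrix (Fin n) (Fin n) ℝ
  b : Matrix (Fin n) (Fin n) ℝ
  l : Matrix (Fin n) (Fin n) ℝ

namespace QuadKernel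

variable {n : ℕ} (K : QuadKernel n) (hb : ℝ)

/-- The phase `φ(x,y)`. -/
def phase (x y : Conf n) : ℝ :=
  K.S + K.P ⬝ᵥ (x.ofLp - K.X) - K.R ⬝ᵥ (y.ofLp - K.Y)
    - (1 / 2) * ((y.ofLp - K.Y) ⬝ᵥ (K.b *ᵥ (y.ofLp - K.Y)))
    + (x.ofLp - K.X) ⬝ᵥ (K.l *ᵥ (y.ofLp - K.Y))
    - (1 / 2) * ((x.ofLp - K.X) ⬝ᵥ (K.a *ᵥ (x.ofLp - K.X)))

/-- The factor of the kernel that depends on `x` only. -/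
def chirpIn : Conf n → ℂ := chirp hb 0 K.P K.a K.X

/-- The factor of the kernel that depends on `y` only. -/
def chirpOut : Conf n → ℂ := chirp hb K.S (-K.R - K.lᵀ *ᵥ K.X) K.b K.Y

/-- The frequency `l(y - Y)/(2πℏ)`. -/
def freq (y : Conf n) : Conf n :=
  Matrix.toEuclideanLin ((2 * Real.pi * hb)⁻¹ • K.l) (y - WithLp.toLp 2 K.Y)

/-- The Schwartz function whose Fourier transform computes the integral. -/
def source (f : 𝓢(Conf n, ℂ)) : 𝓢(Conf n, ℂ) :=
  𝓕 (SchwartzMap.smulLeftCLM ℂ (K.chirpIn hb) f)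

/-- The integral operator `f ↦ ∫ C exp(-i φ(x,·)/ℏ) f(x) dx`, see `apply_eq_integral`. -/
def apply (f : 𝓢(Conf n, ℂ)) (y : Conf n) : ℂ :=
  K.C * (K.chirpOut hb y * K.source hb f (K.freq hb y))

theorem hasTemperateGrowth_chirpIn : Function.HasTemperateGrowth (K.chirpIn hb) :=
  hasTemperateGrowth_chirp _ _ _ _ _

theorem source_add (f g : 𝓢(Conf n, ℂ)) :
    K.source hb (f + g) = K.source hb f + K.source hb g := by
  rw [source, map_add, FourierTransform.fourier_add]; rfl

theorem source_smul (c : ℂ) (f : 𝓢(Conf n, ℂ)) :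
    K.source hb (c • f) = c • K.source hb f := by
  rw [source, map_smul, FourierTransform.fourier_smul]; rfl

theorem apply_add (f g : 𝓢(Conf n, ℂ)) (y : Conf n) :
    K.apply hb (f + g) y = K.apply hb f y + K.apply hb g y := by
  simp only [apply, source_add, _root_.add_apply]; ring

theorem apply_smul (c : ℂ) (f : 𝓢(Conf n, ℂ)) (y : Conf n) :
    K.apply hb (c • f) y = c * K.apply hb f y := by
  simp only [apply, source_smul, _root_.smul_apply, smul_eq_mul]; ring

/-- The value at `y` as a linear functional. -/
def applyₗ (y : Conf n) : 𝓢(Conf n, ℂ) →ₗ[ℂ] ℂ where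
  toFun f := K.apply hb f y
  map_add' f g := K.apply_add hb f g y
  map_smul' c f := K.apply_smul hb c f y

theorem apply_sub (f g : 𝓢(Conf n, ℂ)) (y : Conf n) :
    K.apply hb (f - g) y = K.apply hb f y - K.apply hb g y :=
  map_sub (K.applyₗ hb y) f g

theorem apply_sum {ι : Type*} (s : Finset ι) (f : ι → 𝓢(Conf n, ℂ)) (y : Conf n) :
    K.apply hb (∑ i ∈ s, f i) y = ∑ i ∈ s, K.apply hb (f i) y :=
  map_sum (K.applyₗ hb y) f s

theorem inner_eq_dotProduct (x y : Conf n) : inner ℝ x y = x.ofLp ⬝ᵥ y.ofLp := by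
  rw [EuclideanSpace.inner_eq_star_dotProduct, dotProduct_comm]; simp

theorem inner_freq (x y : Conf n) :
    inner ℝ x (K.freq hb y) = (2 * Real.pi * hb)⁻¹ * (x.ofLp ⬝ᵥ (K.l *ᵥ (y.ofLp - K.Y))) := by
  rw [inner_eq_dotProduct, freq, Matrix.toEuclideanLin, Matrix.toLpLin_apply]
  simp [Matrix.smul_mulVec]

variable {hb}

/-- The cross term `⟨x - X, l(y - Y)⟩` is split: the part with `x` becomes the Fourier exponential,
and the part with `X` is absorbed in the linear term of `chirpOut`. -/
theorem exp_phase (hhb : 0 < hb) (x y : Conf n) :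
    Complex.exp (-(Complex.I / hb * K.phase x y)) = K.chirpOut hb y *
      (Complex.exp ((-2 * Real.pi * inner ℝ x (K.freq hb y) : ℝ) * Complex.I)
        * K.chirpIn hb x) := by
  have h1 : (K.lᵀ *ᵥ K.X) ⬝ᵥ (y.ofLp - K.Y) = K.X ⬝ᵥ (K.l *ᵥ (y.ofLp - K.Y)) := by
    rw [Matrix.mulVec_transpose, Matrix.dotProduct_mulVec]
  have hb0 : (hb : ℂ) ≠ 0 := Complex.ofReal_ne_zero.2 hhb.ne'
  have hpi : (Real.pi : ℂ) ≠ 0 := Complex.ofReal_ne_zero.2 Real.pi_ne_zero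
  rw [chirpOut, chirpIn, chirp, chirp, ← Complex.exp_add, ← Complex.exp_add, inner_freq]
  congr 1
  simp only [phase, quad, sub_dotProduct, neg_dotProduct, h1]
  push_cast
  field_simp
  ring

theorem apply_eq_integral (hhb : 0 < hb) (f : 𝓢(Conf n, ℂ)) (y : Conf n) :
    K.apply hb f y = ∫ x, K.C * Complex.exp (-(Complex.I / hb * K.phase x y)) * f x := by
  rw [apply, source, SchwartzMap.fourier_coe, Real.fourier_eq', ← MeasureTheory.integral_const_mul,
    ← MeasureTheory.integral_const_mul]
  refine MeasureTheory.integral_congr_ae (Filter.Eventually.of_forall fun x => ?_)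
  simp only [K.exp_phase hhb, SchwartzMap.smulLeftCLM_apply_apply (K.hasTemperateGrowth_chirpIn hb),
    smul_eq_mul]
  ring

theorem det_freq (hhb : 0 < hb) : |((2 * Real.pi * hb)⁻¹ • K.l).det|⁻¹
    = (2 * Real.pi * hb) ^ n * |K.l.det|⁻¹ := by
  rw [Matrix.det_smul, Fintype.card_fin, abs_mul, abs_of_pos (by positivity), mul_inv, inv_pow,
    inv_inv]

theorem det_freq_ne_zero (hhb : 0 < hb) (hl : K.l.det ≠ 0) :
    ((2 * Real.pi * hb)⁻¹ • K.l).det ≠ 0 := by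
  rw [Matrix.det_smul]
  exact mul_ne_zero (pow_ne_zero _ (by positivity)) hl

theorem integral_comp_freq (hhb : 0 < hb) (hl : K.l.det ≠ 0) (F : Conf n → ℂ) :
    ∫ y, F (K.freq hb y) = ((2 * Real.pi * hb) ^ n * |K.l.det|⁻¹ : ℝ) * ∫ w, F w := by
  rw [← K.det_freq hhb]
  exact integral_comp_toEuclideanLin (K.det_freq_ne_zero hhb hl) _ F

/-- Plancherel: the chirps are unimodular, and the substitution `w = K.freq hb y` contributes the
Jacobian. -/
theorem scal_apply (hhb : 0 < hb) (hl : K.l.det ≠ 0) (f g : 𝓢(Conf n, ℂ)) :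
    scal (K.apply hb f) (K.apply hb g)
      = (‖K.C‖ ^ 2 * ((2 * Real.pi * hb) ^ n * |K.l.det|⁻¹) : ℝ) * scal f g := by
  have h1 : ∀ y, star (K.apply hb f y) * K.apply hb g y = (‖K.C‖ ^ 2 : ℝ) *
      (star (K.source hb f (K.freq hb y)) * K.source hb g (K.freq hb y)) := fun y => by
    have hc : star (K.chirpOut hb y) * K.chirpOut hb y = 1 := by
      rw [Complex.star_def, Complex.conj_mul', chirpOut, norm_chirp]; simp
    have hC : star K.C * K.C = (‖K.C‖ ^ 2 : ℝ) := by
      rw [Complex.star_def, Complex.conj_mul']; push_cast; rfl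
    rw [← hC, apply, apply, star_mul', star_mul']
    linear_combination (star K.C * K.C * star (K.source hb f (K.freq hb y))
      * K.source hb g (K.freq hb y)) * hc
  have h2 : ∫ w, star (K.source hb f w) * K.source hb g w = ∫ x, star (f x) * g x := by
    have h := SchwartzMap.integral_inner_fourier_fourier
      (SchwartzMap.smulLeftCLM ℂ (K.chirpIn hb) f) (SchwartzMap.smulLeftCLM ℂ (K.chirpIn hb) g)
    have hin : ∀ u v : ℂ, inner ℂ u v = star u * v := fun u v => by
      rw [RCLike.inner_apply, mul_comm]; rfl
    simp only [hin] at h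
    refine h.trans (MeasureTheory.integral_congr_ae (Filter.Eventually.of_forall fun x => ?_))
    have hc : star (K.chirpIn hb x) * K.chirpIn hb x = 1 := by
      rw [Complex.star_def, Complex.conj_mul', chirpIn, norm_chirp]; simp
    simp only [SchwartzMap.smulLeftCLM_apply_apply (K.hasTemperateGrowth_chirpIn hb), smul_eq_mul,
      star_mul']
    linear_combination (star (f x) * g x) * hc
  simp only [scal, h1]
  rw [MeasureTheory.integral_const_mul, K.integral_comp_freq hhb hl
    (fun w => star (K.source hb f w) * K.source hb g w), h2]
  push_cast
  ring

/-- The opposite phase cancels `chirpOut`; after substituting the frequency, Fourier inversion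
returns `chirpIn · f`, whose chirp cancels as well. -/
theorem integral_conj_mul_apply (hhb : 0 < hb) (hl : K.l.det ≠ 0) (f : 𝓢(Conf n, ℂ))
    (x : Conf n) :
    ∫ y, Complex.exp (Complex.I / hb * K.phase x y) * K.apply hb f y
      = K.C * ((2 * Real.pi * hb) ^ n * |K.l.det|⁻¹ : ℝ) * f x := by
  set χ := SchwartzMap.smulLeftCLM ℂ (K.chirpIn hb) f with hχ
  have hin : K.chirpIn hb x ≠ 0 := Complex.exp_ne_zero _
  have h1 : ∀ y, Complex.exp (Complex.I / hb * K.phase x y) * K.apply hb f y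
      = (K.C * (K.chirpIn hb x)⁻¹) *
        (Complex.exp ((2 * Real.pi * inner ℝ (K.freq hb y) x : ℝ) * Complex.I)
          • 𝓕 χ (K.freq hb y)) := fun y => by
    have h := K.exp_phase hhb x y
    rw [← inv_inj, ← Complex.exp_neg, neg_neg, mul_inv, mul_inv, ← Complex.exp_neg] at h
    have hout : K.chirpOut hb y ≠ 0 := Complex.exp_ne_zero _
    have he : -(((-2 * Real.pi * inner ℝ x (K.freq hb y) : ℝ) : ℂ) * Complex.I)
        = (2 * Real.pi * inner ℝ (K.freq hb y) x : ℝ) * Complex.I := by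
      rw [real_inner_comm]; push_cast; ring
    rw [h, he, apply, source, ← hχ, smul_eq_mul]
    field_simp
  simp only [h1]
  rw [MeasureTheory.integral_const_mul, K.integral_comp_freq hhb hl
    (fun w => Complex.exp ((2 * Real.pi * inner ℝ w x : ℝ) * Complex.I) • 𝓕 χ w)]
  have h2 : ∫ w, Complex.exp ((2 * Real.pi * inner ℝ w x : ℝ) * Complex.I) • 𝓕 χ w = χ x := by
    rw [← Real.fourierInv_eq', ← SchwartzMap.fourierInv_coe]
    exact DFunLike.congr_fun (FourierTransform.fourierInv_fourier_eq χ) x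
  rw [h2, hχ, SchwartzMap.smulLeftCLM_apply_apply (K.hasTemperateGrowth_chirpIn hb), smul_eq_mul]
  field_simp

end QuadKernel

end NonlocalGPE

/-! ### Covariance of the phase-space operators under quadratic kernels. -/

namespace NonlocalGPE

open FourierTransform LineDeriv

variable {n : ℕ} (hb : ℝ)

/-- The operators `ẑ` on Schwartz functions. -/
def zSchwartz (k : Idx n) (f : 𝓢(Conf n, ℂ)) : 𝓢(Conf n, ℂ) :=
  match k with
  | Sum.inl j => (-Complex.I * hb) • ∂_{EuclideanSpace.single j (1 : ℝ)} f
  | Sum.inr j => SchwartzMap.smulLeftCLM ℂ (fun x : Conf n => (x j : ℂ)) f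

/-- The operators `Δẑ` on Schwartz functions. -/
def dzSchwartz (z : Idx n → ℝ) (k : Idx n) (f : 𝓢(Conf n, ℂ)) : 𝓢(Conf n, ℂ) :=
  zSchwartz hb k f - (z k : ℂ) • f

theorem zSchwartz_apply (k : Idx n) (f : 𝓢(Conf n, ℂ)) (x : Conf n) :
    zSchwartz hb k f x = zOp hb k f x := by
  rcases k with j | j
  · rfl
  · simp [zSchwartz, zOp, SchwartzMap.smulLeftCLM_apply_apply (hasTemperateGrowth_coord_ofReal j)]

theorem dzSchwartz_apply (z : Idx n → ℝ) (k : Idx n) (f : 𝓢(Conf n, ℂ)) (x : Conf n) :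
    dzSchwartz hb z k f x = dzOp hb z k f x := by
  rw [dzSchwartz, dzOp, ← zSchwartz_apply]; rfl

theorem coe_dzSchwartz (z : Idx n → ℝ) (k : Idx n) (f : 𝓢(Conf n, ℂ)) :
    ⇑(dzSchwartz hb z k f) = dzOp hb z k f :=
  funext (dzSchwartz_apply hb z k f)

theorem dzOp_sum {ι : Type*} (s : Finset ι) (c : ι → ℂ) (f : ι → Conf n → ℂ)
    (hf : ∀ i ∈ s, Differentiable ℝ (f i)) (z : Idx n → ℝ) (k : Idx n) (x : Conf n) :
    dzOp hb z k (fun y => ∑ i ∈ s, c i * f i y) x = ∑ i ∈ s, c i * dzOp hb z k (f i) x := by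
  rcases k with j | j
  · have h : fderiv ℝ (fun y => ∑ i ∈ s, c i * f i y) x = ∑ i ∈ s, c i • fderiv ℝ (f i) x := by
      rw [fderiv_fun_sum fun i hi => (hf i hi x).const_mul _]
      exact Finset.sum_congr rfl fun i hi => fderiv_const_mul (hf i hi x) _
    simp only [dzOp, zOp, h, _root_.sum_apply, _root_.smul_apply,
      smul_eq_mul, Finset.mul_sum, ← Finset.sum_sub_distrib]
    exact Finset.sum_congr rfl fun i _ => by ring
  · simp only [dzOp, zOp, Finset.mul_sum, ← Finset.sum_sub_distrib]
    exact Finset.sum_congr rfl fun i _ => by ring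

namespace QuadKernel

variable (K : QuadKernel n)

/-- The phase-space point `(P, X)`. -/
def zIn : Idx n → ℝ := Sum.elim K.P K.X

/-- The phase-space point `(R, Y)`. -/
def zOut : Idx n → ℝ := Sum.elim K.R K.Y

variable {hb}

theorem exp_phase_eq_chirp (x y : Conf n) :
    Complex.exp (-(Complex.I / hb * K.phase x y)) =
      chirp hb (K.S - K.R ⬝ᵥ (y.ofLp - K.Y)
        - (1 / 2) * ((y.ofLp - K.Y) ⬝ᵥ (K.b *ᵥ (y.ofLp - K.Y))))
        (K.P + K.l *ᵥ (y.ofLp - K.Y)) K.a K.X x := by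
  rw [chirp]
  congr 4
  rw [phase, quad, add_dotProduct, dotProduct_comm (x.ofLp - K.X) (K.l *ᵥ _)]
  ring

/-- Integration by parts in `x`: for fixed `y` the kernel is a chirp of momentum `P + l(y - Y)`, and
the integral of the derivative of chirp times `f` is zero. -/
theorem mul_apply_eq (hhb : 0 < hb) (ha : K.a.IsSymm) (f : 𝓢(Conf n, ℂ)) (y : Conf n) (k : Fin n) :
    ((K.l *ᵥ (y.ofLp - K.Y)) k : ℂ) * K.apply hb f y
      = K.apply hb (dzSchwartz hb K.zIn (Sum.inl k) f) y
        + ∑ m, (K.a k m : ℂ) * K.apply hb (dzSchwartz hb K.zIn (Sum.inr m) f) y := by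
  have hb0 : (hb : ℂ) ≠ 0 := Complex.ofReal_ne_zero.2 hhb.ne'
  set c := K.S - K.R ⬝ᵥ (y.ofLp - K.Y)
        - (1 / 2) * ((y.ofLp - K.Y) ⬝ᵥ (K.b *ᵥ (y.ofLp - K.Y)))
  set p := K.P + K.l *ᵥ (y.ofLp - K.Y) with hp
  have hg := hasTemperateGrowth_chirp hb c p K.a K.X
  set v := SchwartzMap.smulLeftCLM ℂ (chirp hb c p K.a K.X) f with hv
  -- Chosen so that the kernel times `h` is an exact `x_k`-derivative.
  set h := dzSchwartz hb K.zIn (Sum.inl k) f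
    + ∑ m, (K.a k m : ℂ) • dzSchwartz hb K.zIn (Sum.inr m) f
    - ((K.l *ᵥ (y.ofLp - K.Y)) k : ℂ) • f with hh
  have hx : ∀ x, K.C * Complex.exp (-(Complex.I / hb * K.phase x y)) * h x
      = (K.C * (-Complex.I * hb)) * ∂_{EuclideanSpace.single k (1 : ℝ)} v x := fun x => by
    have h1 : ∂_{EuclideanSpace.single k (1 : ℝ)} v x
        = chirp hb c p K.a K.X x * fderiv ℝ f x (EuclideanSpace.single k 1)
          + -(Complex.I / hb) * ((p k - (K.a *ᵥ (x.ofLp - K.X)) k : ℝ) : ℂ)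
            * chirp hb c p K.a K.X x * f x := by
      rw [SchwartzMap.lineDerivOp_apply_eq_fderiv, hv, SchwartzMap.smulLeftCLM_apply hg]
      simp only [smul_eq_mul]
      rw [fderiv_fun_mul (differentiable_chirp hb c p K.a K.X x) (f.differentiableAt)]
      simp only [_root_.add_apply, _root_.smul_apply, smul_eq_mul]
      rw [fderiv_chirp hb c p K.X ha]
      ring
    have h2 : h x = -Complex.I * hb * fderiv ℝ f x (EuclideanSpace.single k 1) - K.P k * f x
        + ((K.a *ᵥ (x.ofLp - K.X)) k : ℂ) * f x
        - ((K.l *ᵥ (y.ofLp - K.Y)) k : ℂ) * f x := by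
      rw [hh]
      simp only [_root_.sub_apply, _root_.add_apply, _root_.sum_apply, _root_.smul_apply,
        dzSchwartz_apply, dzOp, zOp, zIn, Sum.elim_inl, Sum.elim_inr, smul_eq_mul, Matrix.mulVec,
        dotProduct, Pi.sub_apply]
      have hs : ∑ m, (K.a k m : ℂ) * ((x m : ℂ) * f x - (K.X m : ℂ) * f x)
          = (∑ m, (K.a k m : ℂ) * ((x m : ℂ) - (K.X m : ℂ))) * f x := by
        rw [Finset.sum_mul]
        exact Finset.sum_congr rfl fun m _ => by ring
      push_cast
      linear_combination hs
    have hpk : p k = K.P k + (K.l *ᵥ (y.ofLp - K.Y)) k := rfl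
    rw [K.exp_phase_eq_chirp, h1, h2, hpk]
    have hI : -Complex.I * hb * (-(Complex.I / hb)) = -1 := by
      field_simp
      rw [Complex.I_sq]
    push_cast
    linear_combination (-K.C * chirp hb c p K.a K.X x * f x * ((K.P k : ℂ)
      + ((K.l *ᵥ (y.ofLp - K.Y)) k : ℂ) - ((K.a *ᵥ (x.ofLp - K.X)) k : ℂ))) * hI
  have h0 : K.apply hb h y = 0 := by
    rw [K.apply_eq_integral hhb]
    simp only [hx]
    rw [MeasureTheory.integral_const_mul, SchwartzMap.integral_lineDerivOp_eq_zero, mul_zero]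
  rw [hh, apply_sub, apply_add, apply_sum, apply_smul] at h0
  simp only [apply_smul] at h0
  linear_combination -h0

theorem differentiable_freq : Differentiable ℝ (K.freq hb) :=
  (LinearMap.toContinuousLinearMap
    (Matrix.toEuclideanLin ((2 * Real.pi * hb)⁻¹ • K.l))).differentiable.comp
    (differentiable_id.sub_const _)

theorem fderiv_freq (y v : Conf n) : fderiv ℝ (K.freq hb) y v
    = Matrix.toEuclideanLin ((2 * Real.pi * hb)⁻¹ • K.l) v := by
  have h : HasFDerivAt (K.freq hb) ((LinearMap.toContinuousLinearMap
      (Matrix.toEuclideanLin ((2 * Real.pi * hb)⁻¹ • K.l))).comp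
        (ContinuousLinearMap.id ℝ (Conf n))) y :=
    (LinearMap.toContinuousLinearMap (Matrix.toEuclideanLin
      ((2 * Real.pi * hb)⁻¹ • K.l))).hasFDerivAt.comp y ((hasFDerivAt_id y).sub_const _)
  rw [h.fderiv]
  rfl

theorem lineDerivOp_source (hhb : 0 < hb) (f : 𝓢(Conf n, ℂ)) (j : Fin n) (w : Conf n) :
    ∂_{Matrix.toEuclideanLin ((2 * Real.pi * hb)⁻¹ • K.l) (EuclideanSpace.single j (1 : ℝ))}
      (K.source hb f) w
      = -(Complex.I / hb) *
        K.source hb (∑ k, (K.l k j : ℂ) • zSchwartz hb (Sum.inr k) f) w := by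
  have hb0 : (hb : ℂ) ≠ 0 := Complex.ofReal_ne_zero.2 hhb.ne'
  have hpi : (Real.pi : ℂ) ≠ 0 := Complex.ofReal_ne_zero.2 Real.pi_ne_zero
  have hs : ∀ g, -(Complex.I / hb) * K.source hb g w
      = K.source hb ((-(Complex.I / hb)) • g) w := fun g => by rw [source_smul]; rfl
  rw [hs, source, source, SchwartzMap.lineDerivOp_fourier_eq]
  congr 2
  ext x
  have hg : (fun x : Conf n => inner ℝ x (Matrix.toEuclideanLin ((2 * Real.pi * hb)⁻¹ • K.l)
    (EuclideanSpace.single j (1 : ℝ)))).HasTemperateGrowth := by fun_prop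
  have hin : inner ℝ x (Matrix.toEuclideanLin ((2 * Real.pi * hb)⁻¹ • K.l)
      (EuclideanSpace.single j (1 : ℝ))) = (2 * Real.pi * hb)⁻¹ * ∑ k, x k * K.l k j := by
    rw [inner_eq_dotProduct, Matrix.toEuclideanLin, Matrix.toLpLin_apply]
    simp only [PiLp.ofLp_single, Matrix.mulVec_single_one]
    exact dotProduct_smul (2 * Real.pi * hb)⁻¹ x.ofLp (K.l.col j)
  simp only [_root_.smul_apply, SchwartzMap.smulLeftCLM_apply_apply hg,
    SchwartzMap.smulLeftCLM_apply_apply (K.hasTemperateGrowth_chirpIn hb), _root_.sum_apply,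
    zSchwartz_apply, zOp, hin, smul_eq_mul, Complex.real_smul]
  have hsum : ∑ k, (K.l k j : ℂ) * ((x k : ℂ) * f x) = (∑ k, (x k : ℂ) * K.l k j) * f x := by
    rw [Finset.sum_mul]
    exact Finset.sum_congr rfl fun k _ => by ring
  rw [hsum]
  push_cast
  field_simp

theorem dzOp_inl_apply (hhb : 0 < hb) (hbs : K.b.IsSymm) (f : 𝓢(Conf n, ℂ)) (y : Conf n)
    (j : Fin n) :
    dzOp hb K.zOut (Sum.inl j) (K.apply hb f) y
      = ((K.b *ᵥ (y.ofLp - K.Y)) j : ℂ) * K.apply hb f y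
        - ∑ k, (K.l k j : ℂ) * K.apply hb (dzSchwartz hb K.zIn (Sum.inr k) f) y := by
  have hb0 : (hb : ℂ) ≠ 0 := Complex.ofReal_ne_zero.2 hhb.ne'
  have h1 : fderiv ℝ (fun y => K.source hb f (K.freq hb y)) y (EuclideanSpace.single j 1)
      = -(Complex.I / hb) *
        K.source hb (∑ k, (K.l k j : ℂ) • zSchwartz hb (Sum.inr k) f) (K.freq hb y) := by
    have h := fderiv_comp y ((K.source hb f).differentiableAt (x := K.freq hb y))
      (K.differentiable_freq (hb := hb) y)
    rw [← K.lineDerivOp_source hhb, SchwartzMap.lineDerivOp_apply_eq_fderiv, ← K.fderiv_freq y]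
    exact congrArg (fun A => A (EuclideanSpace.single j 1)) h
  have h2 : fderiv ℝ (K.chirpOut hb) y (EuclideanSpace.single j 1) = _ :=
    fderiv_chirp hb K.S (-K.R - K.lᵀ *ᵥ K.X) K.Y hbs y j
  have hd1 : DifferentiableAt ℝ (K.chirpOut hb) y := differentiable_chirp _ _ _ _ _ y
  have hd2 : DifferentiableAt ℝ (fun y => K.source hb f (K.freq hb y)) y :=
    ((K.source hb f).differentiable.comp K.differentiable_freq) y
  have h3 : fderiv ℝ (K.apply hb f) y (EuclideanSpace.single j 1)
      = -(Complex.I / hb) * (((-K.R - K.lᵀ *ᵥ K.X) j - (K.b *ᵥ (y.ofLp - K.Y)) j : ℝ) : ℂ)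
          * K.apply hb f y
        + -(Complex.I / hb)
          * K.apply hb (∑ k, (K.l k j : ℂ) • zSchwartz hb (Sum.inr k) f) y := by
    have h : fderiv ℝ (K.apply hb f) y = _ := fderiv_const_mul (hd1.mul hd2) K.C
    rw [h, _root_.smul_apply, fderiv_mul hd1 hd2]
    simp only [_root_.add_apply, _root_.smul_apply, smul_eq_mul, h1, h2]
    simp only [apply, chirpOut]
    ring
  have hI : -Complex.I * hb * (-(Complex.I / hb)) = -1 := by
    field_simp
    rw [Complex.I_sq]
  have h4 : ∑ k, (K.l k j : ℂ) * K.apply hb (dzSchwartz hb K.zIn (Sum.inr k) f) y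
      = K.apply hb (∑ k, (K.l k j : ℂ) • zSchwartz hb (Sum.inr k) f) y
        - ((K.lᵀ *ᵥ K.X) j : ℂ) * K.apply hb f y := by
    simp only [dzSchwartz, apply_sub, apply_smul, apply_sum, zIn, Sum.elim_inr, Matrix.mulVec,
      dotProduct, Matrix.transpose_apply]
    push_cast
    rw [Finset.sum_mul, ← Finset.sum_sub_distrib]
    exact Finset.sum_congr rfl fun k _ => by ring
  simp only [h4, dzOp, zOp, h3]
  simp only [zOut, Sum.elim_inl, Pi.sub_apply, Pi.neg_apply]
  push_cast
  linear_combination ((-(K.R j : ℂ) - ((K.lᵀ *ᵥ K.X) j : ℂ)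
    - ((K.b *ᵥ (y.ofLp - K.Y)) j : ℂ)) * K.apply hb f y
    + K.apply hb (∑ k, (K.l k j : ℂ) • zSchwartz hb (Sum.inr k) f) y) * hI

/-- The operators `Δẑ` are transformed linearly by the integral operator. -/
theorem dzOp_apply (hhb : 0 < hb) (ha : K.a.IsSymm) (hbs : K.b.IsSymm)
    {L₁ L₂ L₃ L₄ : Matrix (Fin n) (Fin n) ℝ} (h3 : L₃ * K.l = 1) (h4 : L₃ * K.a = L₄)
    (h1 : K.b = L₁ * K.l) (h2 : L₁ * K.a = K.lᵀ + L₂) (f : 𝓢(Conf n, ℂ)) (y : Conf n)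
    (k : Idx n) :
    dzOp hb K.zOut k (K.apply hb f) y
      = ∑ j, ((Matrix.fromBlocks L₁ L₂ L₃ L₄ k j : ℝ) : ℂ)
        * K.apply hb (dzSchwartz hb K.zIn j f) y := by
  set V := K.apply hb f y with hV
  set VP : Fin n → ℂ := fun j => K.apply hb (dzSchwartz hb K.zIn (Sum.inl j) f) y with hVP
  set VX : Fin n → ℂ := fun j => K.apply hb (dzSchwartz hb K.zIn (Sum.inr j) f) y with hVX
  set u := K.l *ᵥ (y.ofLp - K.Y) with hu
  -- Eliminates `y - Y` in favour of shifted operators on `f`. It is used with `N = L₃`, where `L₃ l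
  -- = 1` recovers the position, and with `N = L₁`, where the extra `lᵀ` cancels the term from
  -- differentiating the Fourier transform.
  have key : ∀ (N M' : Matrix (Fin n) (Fin n) ℝ), N * K.a = M' → ∀ j,
      ((N *ᵥ u) j : ℂ) * V = ∑ i, (N j i : ℂ) * VP i + ∑ i, (M' j i : ℂ) * VX i := by
    intro N M' hM j
    have h5 : ∀ i, (N j i : ℂ) * ((u i : ℂ) * V)
        = (N j i : ℂ) * VP i + ∑ m, (N j i : ℂ) * (K.a i m * VX m) := fun i => by
      rw [hu, hV, K.mul_apply_eq hhb ha f y i, mul_add, Finset.mul_sum]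
    have h6 : ((N *ᵥ u) j : ℂ) * V = ∑ i, (N j i : ℂ) * ((u i : ℂ) * V) := by
      simp only [Matrix.mulVec, dotProduct]
      push_cast
      rw [Finset.sum_mul]
      exact Finset.sum_congr rfl fun i _ => by ring
    rw [h6, Finset.sum_congr rfl fun i _ => h5 i, Finset.sum_add_distrib, Finset.sum_comm, ← hM]
    congr 1
    refine Finset.sum_congr rfl fun m _ => ?_
    rw [Matrix.mul_apply]
    push_cast
    rw [Finset.sum_mul]
    exact Finset.sum_congr rfl fun i _ => by ring
  rw [Fintype.sum_sum_type]
  rcases k with j | j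
  · simp only [Matrix.fromBlocks_apply₁₁, Matrix.fromBlocks_apply₁₂]
    have h := key L₁ _ h2 j
    rw [K.dzOp_inl_apply hhb hbs, h1, ← Matrix.mulVec_mulVec, ← hu, ← hV, h]
    simp only [Matrix.add_apply, Matrix.transpose_apply]
    push_cast
    simp only [add_mul, Finset.sum_add_distrib]
    simp only [hVX]
    ring
  · simp only [Matrix.fromBlocks_apply₂₁, Matrix.fromBlocks_apply₂₂]
    have h := key L₃ _ h4 j
    rw [hu, Matrix.mulVec_mulVec, h3, Matrix.one_mulVec] at h
    rw [← h, dzOp, zOp]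
    simp only [zOut, Sum.elim_inr, Pi.sub_apply]
    push_cast
    ring

end QuadKernel

end NonlocalGPE

/-! ### Moments of states and their transport by metaplectic kernels. -/

namespace NonlocalGPE

variable {n : ℕ}

theorem normSq_eq_scal (ψ : Conf n → ℂ) : (normSq ψ : ℂ) = scal ψ ψ := by
  rw [normSq, scal, ← integral_complex_ofReal]
  refine MeasureTheory.integral_congr_ae (Filter.Eventually.of_forall fun x => ?_)
  simp only [Complex.star_def]
  rw [Complex.conj_mul']
  push_cast
  rfl

theorem eq_zero_of_normSq_eq_zero (f : 𝓢(Conf n, ℂ)) (h : normSq f = 0) : f = 0 := by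
  have hi : MeasureTheory.Integrable fun x : Conf n => ‖f x‖ ^ 2 :=
    (MeasureTheory.memLp_two_iff_integrable_sq_norm
      f.continuous.aestronglyMeasurable).1 (f.memLp 2)
  have h1 := (MeasureTheory.integral_eq_zero_iff_of_nonneg (fun x => by positivity) hi).1 h
  have h2 := MeasureTheory.Measure.eq_of_ae_eq h1 (by fun_prop) continuous_zero
  ext x
  simpa using congrFun h2 x

theorem integrable_star_mul (f g : 𝓢(Conf n, ℂ)) :
    MeasureTheory.Integrable fun x => star (f x) * g x :=
  MeasureTheory.MemLp.integrable_mul (p := 2) (q := 2) (f.memLp 2).star (g.memLp 2)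

theorem scal_add (f g h : 𝓢(Conf n, ℂ)) : scal f ⇑(g + h) = scal f g + scal f h := by
  simp only [scal]
  rw [← MeasureTheory.integral_add (integrable_star_mul f g) (integrable_star_mul f h)]
  simp only [_root_.add_apply, mul_add]

theorem scal_smul (c : ℂ) (f g : 𝓢(Conf n, ℂ)) : scal f ⇑(c • g) = c * scal f g := by
  simp only [scal]
  rw [← MeasureTheory.integral_const_mul]
  simp only [_root_.smul_apply, smul_eq_mul, mul_left_comm]

/-- The scalar product with a fixed Schwartz function. -/
def scalₗ (f : 𝓢(Conf n, ℂ)) : 𝓢(Conf n, ℂ) →ₗ[ℂ] ℂ where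
  toFun g := scal f g
  map_add' := scal_add f
  map_smul' c g := scal_smul c f g

theorem scal_sum {ι : Type*} (s : Finset ι) (c : ι → ℂ) (f : 𝓢(Conf n, ℂ))
    (g : ι → 𝓢(Conf n, ℂ)) :
    scal f ⇑(∑ i ∈ s, c i • g i) = ∑ i ∈ s, c i * scal f (g i) := by
  have h := map_sum (scalₗ f) (fun i => c i • g i) s
  simp only [map_smul, smul_eq_mul] at h
  exact h

theorem dzSchwartz_sum {ι : Type*} (hb : ℝ) (z : Idx n → ℝ) (k : Idx n) (s : Finset ι) (c : ι → ℂ)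
    (f : ι → 𝓢(Conf n, ℂ)) :
    dzSchwartz hb z k (∑ i ∈ s, c i • f i) = ∑ i ∈ s, c i • dzSchwartz hb z k (f i) := by
  ext x
  have h : ⇑(∑ i ∈ s, c i • f i) = fun y => ∑ i ∈ s, c i * f i y := by
    funext y
    simp only [_root_.sum_apply, _root_.smul_apply, smul_eq_mul]
  rw [dzSchwartz_apply, h, dzOp_sum hb s c _ fun i _ => (f i).differentiable]
  simp only [_root_.sum_apply, _root_.smul_apply, smul_eq_mul, dzSchwartz_apply]

/-- The first moments of the shifted coordinates vanish at the mean. -/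
theorem re_scal_dzSchwartz_mean (hb : ℝ) (f : 𝓢(Conf n, ℂ)) (h : normSq f ≠ 0) (k : Idx n) :
    (scal f (dzSchwartz hb (mean hb f) k f)).re = 0 := by
  have h1 : scal f (dzSchwartz hb (mean hb f) k f)
      = scal f (zSchwartz hb k f) - (mean hb f k : ℂ) * scal f f := by
    rw [dzSchwartz, sub_eq_add_neg, ← neg_smul, scal_add, scal_smul]
    ring
  have h2 : (scal f (zOp hb k f)).re = mean hb f k * normSq f := by
    rw [mean, div_mul_cancel₀ _ h]
  have h3 : ⇑(zSchwartz hb k f) = zOp hb k f := funext (zSchwartz_apply hb k f)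
  rw [h1, ← normSq_eq_scal, Complex.sub_re, h3, h2, ← Complex.ofReal_mul, Complex.ofReal_re,
    sub_self]

theorem covar_eq (hb : ℝ) (f : 𝓢(Conf n, ℂ)) (j k : Idx n) :
    covar hb f j k = ((scal f (dzSchwartz hb (mean hb f) j (dzSchwartz hb (mean hb f) k f))).re
      + (scal f (dzSchwartz hb (mean hb f) k (dzSchwartz hb (mean hb f) j f))).re)
        / (2 * normSq f) := by
  rw [← Complex.add_re, ← scal_add]
  simp only [covar, Matrix.of_apply, ← coe_dzSchwartz]
  rfl

namespace QuadKernel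

/-- The kernel defines a unitary operator that transforms `Δẑ` by the real matrix `B`. -/
structure IsMetaplectic (K : QuadKernel n) (hb : ℝ) (B : Matrix (Idx n) (Idx n) ℝ) : Prop where
  unitary : ∀ f g, scal (K.apply hb f) (K.apply hb g) = scal f g
  covariant : ∀ f y k, dzOp hb K.zOut k (K.apply hb f) y
    = ∑ j, (B k j : ℂ) * K.apply hb (dzSchwartz hb K.zIn j f) y

namespace IsMetaplectic

variable {K : QuadKernel n} {hb : ℝ} {B : Matrix (Idx n) (Idx n) ℝ}

theorem normSq_apply (hK : K.IsMetaplectic hb B) (f : 𝓢(Conf n, ℂ)) :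
    normSq (K.apply hb f) = normSq f := by
  have h := hK.unitary f f
  rw [← normSq_eq_scal, ← normSq_eq_scal] at h
  exact_mod_cast h

/-- The result is again the operator applied to a Schwartz function, so the rule can be iterated and
unitarity used for second moments. -/
theorem dzOp_apply_eq (hK : K.IsMetaplectic hb B) (f : 𝓢(Conf n, ℂ)) (k : Idx n) :
    dzOp hb K.zOut k (K.apply hb f)
      = K.apply hb (∑ j, (B k j : ℂ) • dzSchwartz hb K.zIn j f) := by
  funext y
  rw [hK.covariant, apply_sum]
  simp only [apply_smul]

theorem mean_apply (hK : K.IsMetaplectic hb B) (f : 𝓢(Conf n, ℂ)) (hf : normSq f ≠ 0)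
    (hz : mean hb f = K.zIn) : mean hb (K.apply hb f) = K.zOut := by
  funext k
  have h1 : zOp hb k (K.apply hb f)
      = K.apply hb (∑ j, (B k j : ℂ) • dzSchwartz hb K.zIn j f + (K.zOut k : ℂ) • f) := by
    funext y
    rw [apply_add, ← hK.dzOp_apply_eq, apply_smul]
    simp [dzOp]
  rw [mean, h1, hK.unitary, hK.normSq_apply, scal_add, scal_sum, scal_smul, ← normSq_eq_scal,
    div_eq_iff hf, Complex.add_re, Complex.re_sum, ← Complex.ofReal_mul, Complex.ofReal_re]
  simp only [Complex.re_ofReal_mul, ← hz, re_scal_dzSchwartz_mean hb f hf]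
  simp

theorem re_scal_sum_dzSchwartz (f : 𝓢(Conf n, ℂ)) (j k : Idx n) :
    (scal f ⇑(∑ m, (B j m : ℂ) • dzSchwartz hb K.zIn m
        (∑ l, (B k l : ℂ) • dzSchwartz hb K.zIn l f))).re
      = ∑ m, ∑ l, B j m * B k l * (scal f (dzSchwartz hb K.zIn m (dzSchwartz hb K.zIn l f))).re := by
  simp only [scal_sum, dzSchwartz_sum, Complex.re_sum, Complex.re_ofReal_mul, Finset.mul_sum,
    mul_assoc]

theorem covar_apply (hK : K.IsMetaplectic hb B) (f : 𝓢(Conf n, ℂ)) (hf : normSq f ≠ 0)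
    (hz : mean hb f = K.zIn) : covar hb (K.apply hb f) = B * covar hb f * Bᵀ := by
  ext j k
  have h1 : (fun x => dzOp hb K.zOut j (dzOp hb K.zOut k (K.apply hb f)) x
      + dzOp hb K.zOut k (dzOp hb K.zOut j (K.apply hb f)) x)
      = K.apply hb (∑ m, (B j m : ℂ) • dzSchwartz hb K.zIn m
          (∑ l, (B k l : ℂ) • dzSchwartz hb K.zIn l f)
        + ∑ m, (B k m : ℂ) • dzSchwartz hb K.zIn m
          (∑ l, (B j l : ℂ) • dzSchwartz hb K.zIn l f)) := by
    funext y
    rw [apply_add]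
    simp only [hK.dzOp_apply_eq]
  rw [covar, Matrix.of_apply, hK.mean_apply f hf hz, h1, hK.unitary, hK.normSq_apply, scal_add,
    Complex.add_re, re_scal_sum_dzSchwartz, re_scal_sum_dzSchwartz]
  set σ : Idx n → Idx n → ℝ := fun m l =>
    (scal f (dzSchwartz hb K.zIn m (dzSchwartz hb K.zIn l f))).re
  simp only [Matrix.mul_apply, Matrix.transpose_apply, covar_eq, hz, Finset.sum_mul]
  -- Relabelling the second sum pairs `σ m l` with `σ l m`, the symmetrization built into the
  -- covariance.
  have h2 : ∑ m, ∑ l, B k m * B j l * σ m l = ∑ m, ∑ l, B j m * B k l * σ l m := by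
    rw [Finset.sum_comm]
    exact Finset.sum_congr rfl fun m _ => Finset.sum_congr rfl fun l _ => by ring
  change (∑ m, ∑ l, B j m * B k l * σ m l + ∑ m, ∑ l, B k m * B j l * σ m l) / _
    = ∑ l, ∑ m, B j m * ((σ m l + σ l m) / _) * B k l
  rw [h2, ← Finset.sum_add_distrib, Finset.sum_div]
  refine Eq.trans ?_ Finset.sum_comm
  refine Finset.sum_congr rfl fun m _ => ?_
  rw [← Finset.sum_add_distrib, Finset.sum_div]
  exact Finset.sum_congr rfl fun l _ => by ring

theorem moments_apply (hK : K.IsMetaplectic hb B) (f : 𝓢(Conf n, ℂ)) (hf : normSq f ≠ 0)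
    (hz : mean hb f = K.zIn) :
    moments hb (K.apply hb f) = (K.zOut, B * covar hb f * Bᵀ) := by
  rw [moments, hK.mean_apply f hf hz, hK.covar_apply f hf hz]

end IsMetaplectic

end QuadKernel

/-! ### The Green function as a metaplectic kernel -/

section Green

variable (Q : Coeffs n) (hb κ : ℝ) (g : ℝ → Moments n) (t s : ℝ)

/-- The kernel `G(·,·,s,t)`, as a function of its second and first argument. -/
def greenKernel : QuadKernel n where
  C := (greenRoot Q hb κ s t)⁻¹
  S := action Q κ g t - action Q κ g s
  P := momP (g t)
  R := momP (g s)
  X := posX (g t)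
  Y := posX (g s)
  a := (lam3 Q κ t s)⁻¹ * lam4 Q κ t s
  b := lam1 Q κ t s * (lam3 Q κ t s)⁻¹
  l := (lam3 Q κ t s)⁻¹

variable {Q hb κ g t s}

theorem green_eq (x y : Conf n) : green Q hb κ g t s x y = (greenRoot Q hb κ t s)⁻¹ *
    Complex.exp (Complex.I / hb * (greenKernel Q hb κ g t s).phase x y) := rfl

theorem green_swap_eq (h : (lam3 Q κ t s).det ≠ 0) (x y : Conf n) :
    green Q hb κ g s t y x = (greenKernel Q hb κ g t s).C *
      Complex.exp (-(Complex.I / hb * (greenKernel Q hb κ g t s).phase x y)) := by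
  have hN := phaseMatrix_swap h
  simp only [phaseMatrix, Matrix.reindex_apply, Equiv.sumComm_symm] at hN
  rw [show ⇑(Equiv.sumComm (Fin n) (Fin n)) = Sum.swap from rfl,
    Matrix.fromBlocks_submatrix_sum_swap_sum_swap, Matrix.fromBlocks_neg,
    Matrix.fromBlocks_inj] at hN
  obtain ⟨h1, h2, -, h4⟩ := hN
  rw [neg_neg] at h2
  rw [green_eq, ← mul_neg, ← Complex.ofReal_neg]
  congr 4
  simp only [greenKernel, QuadKernel.phase, h1, h4]
  simp only [neg_eq_iff_eq_neg.1 h2, Matrix.neg_mulVec, dotProduct_neg]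
  have h5 : (y.ofLp - posX (g s)) ⬝ᵥ (((lam3 Q κ t s)⁻¹)ᵀ *ᵥ (x.ofLp - posX (g t)))
      = (x.ofLp - posX (g t)) ⬝ᵥ ((lam3 Q κ t s)⁻¹ *ᵥ (y.ofLp - posX (g s))) := by
    rw [Matrix.mulVec_transpose, dotProduct_comm, Matrix.dotProduct_mulVec]
  rw [h5]
  ring

theorem norm_factor_greenKernel (hhb : 0 < hb) :
    (2 * Real.pi * hb) ^ n * |((lam3 Q κ t s)⁻¹).det|⁻¹ = ‖greenRoot Q hb κ t s‖ ^ 2 := by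
  rw [norm_sq_greenRoot hhb, Matrix.det_nonsing_inv, Ring.inverse_eq_inv', abs_inv, inv_inv]

theorem greenRoot_ne_zero (hhb : 0 < hb) (h : (lam3 Q κ t s).det ≠ 0) :
    greenRoot Q hb κ t s ≠ 0 := by
  intro h0
  have h1 := norm_sq_greenRoot (Q := Q) (κ := κ) (t := t) (s := s) hhb
  rw [h0, norm_zero, zero_pow two_ne_zero] at h1
  have : 0 < (2 * Real.pi * hb) ^ n * |(lam3 Q κ t s).det| := by positivity
  exact this.ne h1

theorem det_greenKernel_l_ne_zero (h : (lam3 Q κ t s).det ≠ 0) :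
    (greenKernel Q hb κ g t s).l.det ≠ 0 := by
  rw [greenKernel, Matrix.det_nonsing_inv, Ring.inverse_eq_inv']
  exact inv_ne_zero h

/-- The modulus of the Green root is exactly the normalization Plancherel asks for, and the block
relations of the symplectic matriciant are the hypotheses of `dzOp_apply`. -/
theorem isMetaplectic_greenKernel (hhb : 0 < hb) (h : (lam3 Q κ t s).det ≠ 0) :
    (greenKernel Q hb κ g t s).IsMetaplectic hb (matriciant Q κ s t) where
  unitary f f' := by
    have h0 := norm_ne_zero_iff.2 (greenRoot_ne_zero hhb h)
    have h1 : ‖(greenKernel Q hb κ g t s).C‖ ^ 2 * ((2 * Real.pi * hb) ^ n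
        * |(greenKernel Q hb κ g t s).l.det|⁻¹) = 1 := by
      simp only [greenKernel]
      rw [norm_factor_greenKernel hhb, greenRoot_swap hhb h, norm_inv, RCLike.norm_conj]
      field_simp
    rw [QuadKernel.scal_apply _ hhb (det_greenKernel_l_ne_zero h), h1]
    simp
  covariant f y k := by
    have hu : IsUnit (lam3 Q κ t s).det := h.isUnit
    rw [matriciant_swap_eq_fromBlocks]
    refine QuadKernel.dzOp_apply _ hhb (inv_mul_lam4_isSymm h) (lam1_mul_inv_isSymm h)
      (Matrix.mul_nonsing_inv _ hu) (Matrix.mul_nonsing_inv_cancel_left _ _ hu) rfl ?_ f y k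
    exact (Matrix.mul_assoc _ _ _).symm.trans (lam1_mul_inv_mul_lam4 h)

theorem evolInv_eq_apply (hhb : 0 < hb) {ϰ : ℝ} (hts : t ≠ s) (f : 𝓢(Conf n, ℂ))
    (h : (lam3 Q (ϰ * normSq f) t s).det ≠ 0) :
    evolInv Q hb ϰ t s f = (greenKernel Q hb (ϰ * normSq f)
      (hesFlow Q (ϰ * normSq f) t (moments hb f)) t s).apply hb f := by
  funext y
  rw [evolInv, if_neg hts, QuadKernel.apply_eq_integral _ hhb]
  simp only [green_swap_eq h]

theorem integral_green_mul_apply (hhb : 0 < hb) (h : (lam3 Q κ t s).det ≠ 0)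
    (f : 𝓢(Conf n, ℂ)) (x : Conf n) :
    ∫ y, green Q hb κ g t s x y * (greenKernel Q hb κ g t s).apply hb f y = f x := by
  simp only [green_eq, mul_assoc]
  rw [MeasureTheory.integral_const_mul,
    QuadKernel.integral_conj_mul_apply _ hhb (det_greenKernel_l_ne_zero h)]
  simp only [greenKernel]
  have h1 := greenRoot_mul_swap hhb h
  have h2 := greenRoot_ne_zero hhb h
  have h3 := greenRoot_ne_zero hhb (det_lam3_swap_ne_zero h)
  rw [norm_factor_greenKernel hhb, norm_sq_greenRoot hhb, ← h1]
  field_simp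

end Green

end NonlocalGPE
end

/-! ### The inversion formula. -/

theorem mainTheorem6 {n : ℕ} (Q : NonlocalGPE.Coeffs n) (hb : ℝ) (hhb : 0 < hb) (ϰ : ℝ)
    (Ψ : ℝ → SchwartzMap (NonlocalGPE.Conf n) ℂ) (hΨ : NonlocalGPE.IsGPESolution Q hb ϰ Ψ)
    (t s : ℝ)
    (hts : t = s ∨ (NonlocalGPE.lam3 Q (ϰ * NonlocalGPE.normSq (Ψ t)) t s).det ≠ 0)
    (x : NonlocalGPE.Conf n) :
    NonlocalGPE.evol Q hb ϰ t s (NonlocalGPE.evolInv Q hb ϰ t s (Ψ t)) x = Ψ t x := by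
  open NonlocalGPE in
  by_cases hs : t = s
  · rw [evol, if_pos hs, evolInv, if_pos hs]
  have h := hts.resolve_left hs
  rw [evolInv_eq_apply hhb hs (Ψ t) h]
  set κ := ϰ * normSq (Ψ t) with hκ
  set g := hesFlow Q κ t (moments hb (Ψ t)) with hg
  have hK := isMetaplectic_greenKernel (g := g) hhb h
  rw [evol, if_neg hs, hK.normSq_apply, ← hκ]
  -- For the zero state the moments are read as 0 at both times, so the two trajectories may differ;
  -- the integrand vanishes anyway.
  by_cases h0 : normSq (Ψ t) = 0
  · have hz := eq_zero_of_normSq_eq_zero _ h0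
    have h1 : ∀ y, (greenKernel Q hb κ g t s).apply hb (Ψ t) y = 0 := fun y => by
      rw [hz]; exact map_zero ((greenKernel Q hb κ g t s).applyₗ hb y)
    simp only [h1, mul_zero, MeasureTheory.integral_zero]
    rw [hz]
    rfl
  · have hgt : g t = moments hb (Ψ t) := (hesFlow_spec Q κ t _).2
    have hin : mean hb (Ψ t) = (greenKernel Q hb κ g t s).zIn := by
      have : mean hb (Ψ t) = (g t).1 := by rw [hgt]; rfl
      rw [this]
      funext k
      rcases k with k | k <;> rfl
    have hout : (greenKernel Q hb κ g t s).zOut = (g s).1 := by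
      funext k
      rcases k with k | k <;> rfl
    have hm : moments hb ((greenKernel Q hb κ g t s).apply hb (Ψ t)) = g s := by
      rw [hK.moments_apply (Ψ t) h0 hin, hout]
      refine Prod.ext rfl ?_
      rw [hg, hesFlow_snd]
      rfl
    -- The outer trajectory starts at time `s` from `g s`, hence is `g` itself.
    rw [hm, hg, hesFlow_hesFlow, ← hg]
    exact integral_green_mul_apply hhb h (Ψ t) x
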